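/- Let $\mathscr{M}=(\underline{M},\otimes,I)$ be a symmetric monoidal closed category whose underlying category is equipped with a model structure that is combinatorial and left proper (for instance a combinatorial, left proper symmetric monoidal model category; the compatibility axioms between $\otimes$ and the model structure are not needed). Let $\Phi_{\mathrm{epi}}$ be the category of the finite sets $\mathbf{n}=\{0,\dots,n-1\}$, $n\ge 0$, and surjections, symmetric monoidal under disjoint union $+$, and let $\Phi_{\mathrm{epi}}^{+}$ be its full subcategory of nonempty sets. A commutative (co-Segal) premonoid in $\mathscr{M}$ is a symmetric lax monoidal functor $\mathcal{F}:(\Phi_{\mathrm{epi}}^{\mathrm{op}},+,\mathbf{0})\to\mathscr{M}$, with laxity maps $\varphi:\mathcal{F}(\mathbf{n})\otimes\mathcal{F}(\mathbf{m})\to\mathcal{F}(\mathbf{n}+\mathbf{m})$, that is normal (with $\mathcal{F}(\mathbf{0})=I$ and structure map $I\to\mathcal{F}(\mathbf{0})$ the identity), together with a map $e:I\to\mathcal{F}(\mathbf{1})$ such that $$I\otimes\mathcal{F}(\mathbf{1})\xrightarrow{e\otimes\mathrm{Id}}\mathcal{F}(\mathbf{1})\otimes\mathcal{F}(\mathbf{1})\xrightarrow{\varphi}\mathcal{F}(\mathbf{2})$$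 equals the composite $I\otimes\mathcal{F}(\mathbf{1})\cong\mathcal{F}(\mathbf{1})\to\mathcal{F}(\mathbf{2})$, the last map being induced by $\mathbf{2}\to\mathbf{1}$. A morphism is a natural transformation, with component $\mathrm{Id}_I$ at $\mathbf{0}$, that is compatible with the maps $\varphi$ and $e$. Let $\mathcal{C}$ be the category of commutative premonoids, $\mathcal{U}:\mathcal{C}\to\mathrm{Hom}((\Phi_{\mathrm{epi}}^{+})^{\mathrm{op}},\mathscr{M})$ the forgetful functor, and $\mathrm{Ev}_{\mathbf 1}:\mathcal{C}\to\mathscr{M}$, $\mathcal{F}\mapsto\mathcal{F}(\mathbf{1})$. Let $\mathbf{F}^{\mathbf 1}:\mathscr{M}\to\mathrm{Hom}((\Phi_{\mathrm{epi}}^{+})^{\mathrm{op}},\mathscr{M})$ be the constant diagram functor. Then $\mathcal{U}$ has a left adjoint $\Gamma$, and the following hold. 1. There is a combinatorial model structure on $\mathcal{C}$ in which a map $\sigma:\mathcal{F}\to\mathcal{G}$ is a weak equivalence (resp. a fibration) if and only if $\sigma_{\mathbf 1}:\mathcal{F}(\mathbf{1})\to\mathcal{G}(\mathbf{1})$ is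 a weak equivalence (resp. a fibration) in $\mathscr{M}$, and in which a map is a cofibration if and only if it has the left lifting property against every map that is both a weak equivalence and a fibration. 2. This model structure is left proper. 3. If $\mathbf{I}$ is a set of generating cofibrations of $\mathscr{M}$ and $\mathbf{J}$ is a set of generating trivial cofibrations of $\mathscr{M}$, then $\Gamma\mathbf{F}^{\mathbf 1}(\mathbf{I})$ is a set of generating cofibrations and $\Gamma\mathbf{F}^{\mathbf 1}(\mathbf{J})$ is a set of generating trivial cofibrations of this model structure. 4. $\Gamma\mathbf{F}^{\mathbf 1}$ is left adjoint to $\mathrm{Ev}_{\mathbf 1}$, and this adjunction is a Quillen adjunction, with $\Gamma\mathbf{F}^{\mathbf 1}$ left Quillen and $\mathrm{Ev}_{\mathbf 1}$ right Quillen. -/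

import Mathlib

open CategoryTheory Limits MonoidalCategory HomotopicalAlgebra Opposite

universe v u

namespace CoSegal

/-- The objects of the category of nonempty finite sets `{0, …, n - 1}`, `n ≥ 1`. -/
structure FinEpi : Type where
  card : ℕ
  card_pos : 0 < card

namespace FinEpi

/-- The category structure: the morphisms `n ⟶ m` are the surjective functions
`{0, …, n - 1} → {0, …, m - 1}`. -/
instance : Category.{0} FinEpi where
  Hom n m := { f : Fin n.card → Fin m.card // Function.Surjective f }
  id n := ⟨id, Function.surjective_id⟩
  comp f g := ⟨g.1 ∘ f.1, g.2.comp f.2⟩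

/-- The one element set. -/
def one : FinEpi := ⟨1, Nat.one_pos⟩

/-- The unique surjection `n ⟶ 1`. -/
def toOne (n : FinEpi) : n ⟶ one :=
  ⟨fun _ => (0 : Fin 1), fun _ => ⟨⟨0, n.card_pos⟩, (Subsingleton.elim (α := Fin 1) _ _)⟩⟩

/-- The disjoint union on objects: the elements of `n` come first, then those of `m`. -/
def add (n m : FinEpi) : FinEpi := ⟨n.card + m.card, Nat.add_pos_left n.card_pos _⟩

/-- The disjoint union of two surjections. -/
def sum {n n' m m' : FinEpi} (f : n ⟶ n') (g : m ⟶ m') : add n m ⟶ add n' m' :=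
  ⟨fun i => finSumFinEquiv (Sum.map f.1 g.1 (finSumFinEquiv.symm i)),
    finSumFinEquiv.surjective.comp
      ((Sum.map_surjective.2 ⟨f.2, g.2⟩).comp finSumFinEquiv.symm.surjective)⟩

/-- The associativity bijection `(n + m) + k ⟶ n + (m + k)`; it preserves the values. -/
def assoc (n m k : FinEpi) : add (add n m) k ⟶ add n (add m k) :=
  ⟨finCongr (Nat.add_assoc n.card m.card k.card), (finCongr _).surjective⟩

/-- The symmetry bijection `n + m ⟶ m + n`, which exchanges the two blocks. -/
def swap (n m : FinEpi) : add n m ⟶ add m n :=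
  ⟨finAddFlip (m := n.card) (n := m.card), (finAddFlip).surjective⟩

end FinEpi

variable (M : Type u) [Category.{v} M] [MonoidalCategory M] [SymmetricCategory M]

/-- A commutative (co-Segal) premonoid in `M`: a normal symmetric lax monoidal functor from the
opposite of the category of finite sets and surjections (with disjoint union) to `M`, with a weak
unit `I ⟶ F(1)`. As the empty set is isolated in that category and is sent to the unit object
(with the identity as structure map, which forces the laxity maps involving the empty set to be the
unitors of `M`), the data is recorded on nonempty finite sets only. -/
structure CommPremonoid where
  /-- the underlying diagram -/
  diagram : FinEpiᵒᵖ ⥤ M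
  /-- the laxity maps `F(n) ⊗ F(m) ⟶ F(n + m)` -/
  lax (n m : FinEpi) :
    diagram.obj (op n) ⊗ diagram.obj (op m) ⟶ diagram.obj (op (FinEpi.add n m))
  lax_natural {n n' m m' : FinEpi} (f : n' ⟶ n) (g : m' ⟶ m) :
    (diagram.map f.op ⊗ₘ diagram.map g.op) ≫ lax n' m' =
      lax n m ≫ diagram.map (FinEpi.sum f g).op
  lax_assoc (n m k : FinEpi) :
    (lax n m ▷ diagram.obj (op k)) ≫ lax (FinEpi.add n m) k =
      (α_ (diagram.obj (op n)) (diagram.obj (op m)) (diagram.obj (op k))).hom ≫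
        (diagram.obj (op n) ◁ lax m k) ≫ lax n (FinEpi.add m k) ≫
          diagram.map (FinEpi.assoc n m k).op
  lax_symm (n m : FinEpi) :
    lax n m ≫ diagram.map (FinEpi.swap m n).op =
      (β_ (diagram.obj (op n)) (diagram.obj (op m))).hom ≫ lax m n
  /-- the unit `I ⟶ F(1)` -/
  unit : 𝟙_ M ⟶ diagram.obj (op FinEpi.one)
  unit_lax :
    (unit ▷ diagram.obj (op FinEpi.one)) ≫ lax FinEpi.one FinEpi.one =
      (λ_ (diagram.obj (op FinEpi.one))).hom ≫
        diagram.map (FinEpi.toOne (FinEpi.add FinEpi.one FinEpi.one)).op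

namespace CommPremonoid

variable {M}

/-- Morphisms of commutative premonoids: natural transformations compatible with the laxity maps
and with the units. -/
@[ext]
structure Hom (F G : CommPremonoid M) where
  /-- the underlying natural transformation -/
  nat : F.diagram ⟶ G.diagram
  nat_lax (n m : FinEpi) :
    F.lax n m ≫ nat.app (op (FinEpi.add n m)) =
      (nat.app (op n) ⊗ₘ nat.app (op m)) ≫ G.lax n m
  nat_unit : F.unit ≫ nat.app (op FinEpi.one) = G.unit

/-- The category of commutative premonoids in `M`. -/
instance : Category.{v} (CommPremonoid M) where
  Hom F G := Hom F G
  id F :=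
    { nat := 𝟙 F.diagram
      nat_lax := by intros; simp
      nat_unit := by simp }
  comp σ τ :=
    { nat := σ.nat ≫ τ.nat
      nat_lax := by
        intro n m
        rw [NatTrans.comp_app, ← Category.assoc, σ.nat_lax, Category.assoc, τ.nat_lax,
          ← Category.assoc, tensorHom_comp_tensorHom, NatTrans.comp_app, NatTrans.comp_app]
      nat_unit := by
        rw [NatTrans.comp_app, ← Category.assoc, σ.nat_unit, τ.nat_unit] }
  id_comp σ := Hom.ext (Category.id_comp σ.nat)
  comp_id σ := Hom.ext (Category.comp_id σ.nat)
  assoc σ τ ρ := Hom.ext (Category.assoc σ.nat τ.nat ρ.nat)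

variable (M)

/-- The forgetful functor from commutative premonoids to diagrams. -/
def forget : CommPremonoid M ⥤ (FinEpiᵒᵖ ⥤ M) where
  obj F := F.diagram
  map σ := Hom.nat σ

/-- The evaluation of a commutative premonoid at the one element set. -/
def evOne : CommPremonoid M ⥤ M :=
  forget M ⋙ (evaluation FinEpiᵒᵖ M).obj (op FinEpi.one)

end CommPremonoid

end CoSegal

namespace ModelCat

variable (C : Type u) [Category.{v} C]

/-- Left properness: weak equivalences are stable under cobase change along cofibrations. -/
class IsLeftProper [CategoryWithCofibrations C] [CategoryWithWeakEquivalences C] : Prop where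
  weakEquivalence_of_isPushout {A B X Y : C} {i : A ⟶ B} {f : A ⟶ X} {g : B ⟶ Y} {j : X ⟶ Y}
    (sq : IsPushout i f g j) (hi : Cofibration i) (hf : WeakEquivalence f) : WeakEquivalence g

variable {C}

/-- `I` is a set of generating cofibrations: it is a set of maps which permits the small object
argument and which detects the trivial fibrations. -/
structure IsGeneratingCofibrations [ModelCategory C] (I : MorphismProperty C) : Prop where
  smallObjectArgument : MorphismProperty.HasSmallObjectArgument.{v} I
  rlp_eq : I.rlp = trivialFibrations C

/-- `J` is a set of generating trivial cofibrations: it is a set of maps which permits the small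
object argument and which detects the fibrations. -/
structure IsGeneratingTrivialCofibrations [ModelCategory C] (J : MorphismProperty C) : Prop where
  smallObjectArgument : MorphismProperty.HasSmallObjectArgument.{v} J
  rlp_eq : J.rlp = fibrations C

variable (C)

/-- Combinatorial model categories: cofibrantly generated and locally presentable. -/
class IsCombinatorial [ModelCategory C] : Prop where
  isLocallyPresentable : IsLocallyPresentable.{v} C
  exists_generatingCofibrations : ∃ I : MorphismProperty C, IsGeneratingCofibrations I
  exists_generatingTrivialCofibrations :
    ∃ J : MorphismProperty C, IsGeneratingTrivialCofibrations J

variable {C}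

/-- An adjunction `L ⊣ R` between model categories is a Quillen adjunction: `L` is left Quillen and
`R` is right Quillen. -/
structure IsQuillenAdjunction {D : Type*} [Category D] [ModelCategory C] [ModelCategory D]
    {L : C ⥤ D} {R : D ⥤ C} (_adj : L ⊣ R) : Prop where
  cofibrations_le : cofibrations C ≤ (cofibrations D).inverseImage L
  trivialCofibrations_le : trivialCofibrations C ≤ (trivialCofibrations D).inverseImage L
  fibrations_le : fibrations D ≤ (fibrations C).inverseImage R
  trivialFibrations_le : trivialFibrations D ≤ (trivialFibrations C).inverseImage R

end ModelCat

-- The one element set is not a sum of two nonempty sets, and a surjection out of it is a bijection.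
-- So the only structure map of a premonoid that lands in `F(1)` from elsewhere is the unit.
-- Consequently a map `w : F(1) ⟶ W` extends uniquely to a map from `F` to the premonoid which is
-- `W` at level 1 and terminal elsewhere, with unit `F.unit ≫ w` (`exists_hom_cofree`,
-- `cofree_hom_ext`): viewed as a functor to objects under `I`, `evOne` has a right adjoint. Hence
-- pushouts of premonoids are pushouts in `M` at level 1 (`isPushout_evOne_map`). Likewise the left
-- adjoint `L` of `evOne` satisfies `L(X)(1) = X ⨿ I`, which appears here as the statement that
-- naturality squares of the adjunction unit are pushouts (`isPushout_unit`).
--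
-- These two properties (`IsCellular`) make the transfer of the model structure formal. Given a
-- factorization `F(1) ⟶ Z ⟶ G(1)` of `evOne f`, push `L(F(1)) ⟶ L(Z)` out along the counit: the
-- result has value `Z` at level 1. So factorizations lift from `M` with no transfinite
-- construction, and the first factor is already a (trivial) cofibration at level 1. This yields the
-- model axioms, and left properness because pushouts and cofibrations are visible in `M`.
--
-- The remaining work is to show that premonoids form a locally presentable category with a left
-- adjoint to the forgetful functor. Premonoids are given by generators and relations
-- (`exists_presentation`): free lax data are coproducts over formal expressions, and relations are
-- imposed by levelwise reflexive coequalizers, which the tensor product respects because `M` is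
-- closed. Presentations give `Γ` and all colimits. Sifted colimits are levelwise, so the
-- evaluations are accessible right adjoints that jointly reflect equality and isomorphisms; their
-- left adjoints carry a strong generator of `M` to one of premonoids. Local presentability then
-- supplies the small object argument.

universe w

/-! ### Epimorphisms and coproducts in a closed symmetric monoidal category -/

namespace CategoryTheory.MonoidalCategory

section

variable {M : Type u} [Category.{v} M] [MonoidalCategory M] [SymmetricCategory M] [MonoidalClosed M]

/-- Closedness makes `X ⊗ -` a left adjoint, so it preserves epimorphisms; the braiding handles the
other variable. -/
lemma epi_tensorHom {X Y X' Y' : M} (f : X ⟶ Y) (g : X' ⟶ Y') [Epi f] [Epi g] :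
    Epi (f ⊗ₘ g) := by
  have : Epi (X ◁ g) := inferInstanceAs (Epi ((tensorLeft X).map g))
  have : Epi (f ▷ Y') := by
    have e : f ▷ Y' = (β_ X Y').hom ≫ Y' ◁ f ≫ (β_ Y Y').inv := by
      rw [← Category.assoc, ← BraidedCategory.braiding_naturality_left, Category.assoc,
        Iso.hom_inv_id, Category.comp_id]
    have : Epi (Y' ◁ f) := inferInstanceAs (Epi ((tensorLeft Y').map f))
    rw [e]
    infer_instance
  rw [tensorHom_def']
  infer_instance

variable {ι κ : Type*} {X : ι → M} {Y : κ → M} [HasCoproduct X] [HasCoproduct Y] {Z : M}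

/-- Morphisms from a tensor product of two coproducts. -/
noncomputable def sigmaTensorDesc (φ : ∀ i j, X i ⊗ Y j ⟶ Z) : (∐ X) ⊗ (∐ Y) ⟶ Z :=
  MonoidalClosed.uncurry (Limits.Sigma.desc fun j => MonoidalClosed.curry
    ((β_ _ _).hom ≫ MonoidalClosed.uncurry (Limits.Sigma.desc fun i => MonoidalClosed.curry
      ((β_ _ _).hom ≫ φ i j))))

@[simp]
lemma tensorHom_sigmaTensorDesc (φ : ∀ i j, X i ⊗ Y j ⟶ Z) (i : ι) (j : κ) :
    (Sigma.ι X i ⊗ₘ Sigma.ι Y j) ≫ sigmaTensorDesc φ = φ i j := by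
  rw [tensorHom_def, Category.assoc, sigmaTensorDesc, ← MonoidalClosed.uncurry_natural_left,
    Sigma.ι_desc, MonoidalClosed.uncurry_curry, ← Category.assoc,
    BraidedCategory.braiding_naturality_left, Category.assoc,
    ← MonoidalClosed.uncurry_natural_left, Sigma.ι_desc, MonoidalClosed.uncurry_curry,
    SymmetricCategory.symmetry_assoc]

lemma sigmaTensor_hom_ext {f g : (∐ X) ⊗ (∐ Y) ⟶ Z}
    (h : ∀ i j, (Sigma.ι X i ⊗ₘ Sigma.ι Y j) ≫ f = (Sigma.ι X i ⊗ₘ Sigma.ι Y j) ≫ g) : f = g := by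
  apply MonoidalClosed.curry_injective
  refine Sigma.hom_ext _ _ fun j => ?_
  rw [← MonoidalClosed.curry_natural_left, ← MonoidalClosed.curry_natural_left]
  congr 1
  rw [← cancel_epi (β_ (Y j) (∐ X)).hom]
  apply MonoidalClosed.curry_injective
  refine Sigma.hom_ext _ _ fun i => ?_
  rw [← MonoidalClosed.curry_natural_left, ← MonoidalClosed.curry_natural_left]
  congr 1
  have := h i j
  rw [tensorHom_def, Category.assoc, Category.assoc] at this
  rw [← cancel_epi (β_ (X i) (Y j)).hom, ← Category.assoc, ← Category.assoc (β_ _ _).hom,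
    ← BraidedCategory.braiding_naturality_left]
  simpa using this

end

end CategoryTheory.MonoidalCategory

/-! ### Lax data: the operations of a premonoid without its axioms -/

namespace CoSegal

variable (M : Type u) [Category.{v} M] [MonoidalCategory M]

/-- A diagram on finite sets and surjections with laxity maps and a unit which are not subject to
any condition. -/
structure LaxData where
  /-- the underlying diagram -/
  diagram : FinEpiᵒᵖ ⥤ M
  /-- the laxity maps -/
  lax (n m : FinEpi) :
    diagram.obj (op n) ⊗ diagram.obj (op m) ⟶ diagram.obj (op (FinEpi.add n m))
  /-- the unit -/
  unit : 𝟙_ M ⟶ diagram.obj (op FinEpi.one)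

namespace LaxData

variable {M}

/-- Morphisms of lax data. -/
@[ext]
structure Hom (A B : LaxData M) where
  /-- the underlying natural transformation -/
  nat : A.diagram ⟶ B.diagram
  nat_lax (n m : FinEpi) :
    A.lax n m ≫ nat.app (op (FinEpi.add n m)) =
      (nat.app (op n) ⊗ₘ nat.app (op m)) ≫ B.lax n m
  nat_unit : A.unit ≫ nat.app (op FinEpi.one) = B.unit

instance : Category (LaxData M) where
  Hom := Hom
  id A := { nat := 𝟙 _, nat_lax := by simp, nat_unit := by simp }
  comp f g :=
    { nat := f.nat ≫ g.nat
      nat_lax n m := by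
        simp only [NatTrans.comp_app, reassoc_of% (f.nat_lax n m), g.nat_lax, tensorHom_comp_tensorHom_assoc]
      nat_unit := by simp only [NatTrans.comp_app, reassoc_of% f.nat_unit, g.nat_unit] }
  id_comp f := Hom.ext (Category.id_comp f.nat)
  comp_id f := Hom.ext (Category.comp_id f.nat)
  assoc f g h := Hom.ext (Category.assoc f.nat g.nat h.nat)

/-- The object of a lax datum at a finite set. -/
abbrev obj (A : LaxData M) (n : FinEpi) : M := A.diagram.obj (op n)

/-- The action of surjections on a lax datum. -/
abbrev map (A : LaxData M) {n m : FinEpi} (f : n ⟶ m) : A.obj m ⟶ A.obj n := A.diagram.map f.op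

@[simp]
lemma map_id (A : LaxData M) (n : FinEpi) : A.map (𝟙 n) = 𝟙 _ :=
  A.diagram.map_id _

@[simp]
lemma map_comp (A : LaxData M) {n m k : FinEpi} (f : n ⟶ m) (g : m ⟶ k) :
    A.map (f ≫ g) = A.map g ≫ A.map f :=
  A.diagram.map_comp _ _

/-- The components of a morphism of lax data. -/
def Hom.app {A B : LaxData M} (f : A ⟶ B) (n : FinEpi) : A.obj n ⟶ B.obj n :=
  (Hom.nat f).app (op n)

@[ext]
lemma hom_ext {A B : LaxData M} {f g : A ⟶ B} (h : ∀ n, Hom.app f n = Hom.app g n) : f = g :=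
  Hom.ext (NatTrans.ext (funext fun n => h n.unop))

@[simp]
lemma comp_app {A B D : LaxData M} (f : A ⟶ B) (g : B ⟶ D) (n : FinEpi) :
    Hom.app (f ≫ g) n = Hom.app f n ≫ Hom.app g n := rfl

lemma Hom.map_app {A B : LaxData M} (f : A ⟶ B) {n m : FinEpi} (g : n ⟶ m) :
    A.map g ≫ Hom.app f n = Hom.app f m ≫ B.map g :=
  (Hom.nat f).naturality g.op

lemma Hom.lax_app {A B : LaxData M} (f : A ⟶ B) (n m : FinEpi) :
    A.lax n m ≫ Hom.app f (FinEpi.add n m) = (Hom.app f n ⊗ₘ Hom.app f m) ≫ B.lax n m :=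
  Hom.nat_lax f n m

lemma Hom.unit_app {A B : LaxData M} (f : A ⟶ B) :
    A.unit ≫ Hom.app f FinEpi.one = B.unit :=
  Hom.nat_unit f

/-- Constructor for morphisms of lax data. -/
def homMk {A B : LaxData M} (φ : ∀ n, A.obj n ⟶ B.obj n)
    (h : ∀ {n m : FinEpi} (f : n ⟶ m), A.map f ≫ φ n = φ m ≫ B.map f)
    (hl : ∀ n m, A.lax n m ≫ φ (FinEpi.add n m) = (φ n ⊗ₘ φ m) ≫ B.lax n m)
    (hu : A.unit ≫ φ FinEpi.one = B.unit) : A ⟶ B where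
  nat := { app n := φ n.unop, naturality _ _ f := h f.unop }
  nat_lax := hl
  nat_unit := hu

@[simp]
lemma homMk_app {A B : LaxData M} (φ : ∀ n, A.obj n ⟶ B.obj n) (h hl hu) (n : FinEpi) :
    Hom.app (homMk (A := A) (B := B) φ h hl hu) n = φ n := rfl

end LaxData

/-! ### Free lax data -/

/-- Formal expressions in the operations of lax data whose value lives over the set `n`, in
variables indexed by the nonempty finite sets. -/
inductive Tree : FinEpi → Type
  | leaf {n m : FinEpi} (f : n ⟶ m) : Tree n
  | node {n a b : FinEpi} (f : n ⟶ FinEpi.add a b) (s : Tree a) (t : Tree b) : Tree n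
  | unit {n : FinEpi} (f : n ⟶ FinEpi.one) : Tree n

variable {M : Type u} [Category.{v} M] [MonoidalCategory M]

/-- The tensor product of the variables which occur in an expression. -/
def Tree.val (X : FinEpi → M) : {n : FinEpi} → Tree n → M
  | _, .leaf (m := m) _ => X m
  | _, .node _ s t => s.val X ⊗ t.val X
  | _, .unit _ => 𝟙_ M

/-- The evaluation of an expression in a lax datum. -/
def Tree.eval {X : FinEpi → M} {A : LaxData M} (x : ∀ n, X n ⟶ A.obj n) :
    {n : FinEpi} → (t : Tree n) → (t.val X ⟶ A.obj n)
  | _, .leaf (m := m) f => x m ≫ A.map f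
  | _, .node (a := a) (b := b) f s t => (s.eval x ⊗ₘ t.eval x) ≫ A.lax a b ≫ A.map f
  | _, .unit f => A.unit ≫ A.map f

namespace LaxData

variable (X : FinEpi → M) [HasColimits M]

/-- Expressions form a type in the lowest universe, whereas `M` has colimits of size `v`; any such
type is `v`-small. -/
instance (priority := low) hasCoproductsOfShape_of_type (ι : Type) :
    HasColimitsOfShape (Discrete ι) M :=
  hasColimitsOfShape_of_equivalence (Discrete.equivalence (equivShrink.{v} ι).symm)

/-- The coproduct of the values of all expressions. -/
noncomputable def freeObj (n : FinEpi) : M := ∐ fun t : Tree n => t.val X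

/-- The inclusion of the value of an expression. -/
noncomputable def freeInc {n : FinEpi} (t : Tree n) : t.val X ⟶ freeObj X n :=
  Limits.Sigma.ι (fun t : Tree n => t.val X) t

/-- The inclusion of the value of a variable. -/
noncomputable def freeLeaf {n m : FinEpi} (f : n ⟶ m) : X m ⟶ freeObj X n :=
  freeInc X (.leaf f)

/-- The inclusion of the value of a product of two expressions. -/
noncomputable def freeNode {n a b : FinEpi} (f : n ⟶ FinEpi.add a b) (s : Tree a) (t : Tree b) :
    s.val X ⊗ t.val X ⟶ freeObj X n :=
  freeInc X (.node f s t)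

/-- The inclusion of the formal unit. -/
noncomputable def freeUnit {n : FinEpi} (f : n ⟶ FinEpi.one) : 𝟙_ M ⟶ freeObj X n :=
  freeInc X (.unit f)

variable {X} in
lemma freeObj_hom_ext {n : FinEpi} {Z : M} {p q : freeObj X n ⟶ Z}
    (hl : ∀ {m} (f : n ⟶ m), freeLeaf X f ≫ p = freeLeaf X f ≫ q)
    (hn : ∀ {a b} (f : n ⟶ FinEpi.add a b) (s : Tree a) (t : Tree b),
      freeNode X f s t ≫ p = freeNode X f s t ≫ q)
    (hu : ∀ f : n ⟶ FinEpi.one, freeUnit X f ≫ p = freeUnit X f ≫ q) : p = q := by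
  refine Limits.Sigma.hom_ext _ _ fun t => ?_
  cases t with
  | leaf f => exact hl f
  | node f s t => exact hn f s t
  | unit f => exact hu f

/-- Morphisms from the free object. -/
noncomputable def freeDesc {n : FinEpi} {Z : M} (φ : ∀ t : Tree n, t.val X ⟶ Z) :
    freeObj X n ⟶ Z :=
  Limits.Sigma.desc φ

@[simp]
lemma freeInc_desc {n : FinEpi} {Z : M} (φ : ∀ t : Tree n, t.val X ⟶ Z) (t : Tree n) :
    freeInc X t ≫ freeDesc X φ = φ t :=
  Limits.Sigma.ι_desc _ _

/-- Morphisms from the free object given on each kind of expressions. -/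
noncomputable def freeCases {n : FinEpi} {Z : M} (l : ∀ {m : FinEpi} (_ : n ⟶ m), X m ⟶ Z)
    (d : ∀ {a b : FinEpi} (_ : n ⟶ FinEpi.add a b) (s : Tree a) (t : Tree b),
      s.val X ⊗ t.val X ⟶ Z)
    (e : ∀ _ : n ⟶ FinEpi.one, 𝟙_ M ⟶ Z) : freeObj X n ⟶ Z :=
  freeDesc X fun
    | .leaf f => l f
    | .node f s t => d f s t
    | .unit f => e f

/-- The action of a surjection on the free object. -/
noncomputable def freeMap {n n' : FinEpi} (g : n' ⟶ n) : freeObj X n ⟶ freeObj X n' :=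
  freeCases X (fun f => freeLeaf X (g ≫ f)) (fun f s t => freeNode X (g ≫ f) s t)
    (fun f => freeUnit X (g ≫ f))

@[simp]
lemma freeLeaf_map {n n' m : FinEpi} (g : n' ⟶ n) (f : n ⟶ m) :
    freeLeaf X f ≫ freeMap X g = freeLeaf X (g ≫ f) :=
  freeInc_desc _ _ _

@[simp]
lemma freeNode_map {n n' a b : FinEpi} (g : n' ⟶ n) (f : n ⟶ FinEpi.add a b) (s : Tree a)
    (t : Tree b) : freeNode X f s t ≫ freeMap X g = freeNode X (g ≫ f) s t :=
  freeInc_desc _ _ _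

@[simp]
lemma freeUnit_map {n n' : FinEpi} (g : n' ⟶ n) (f : n ⟶ FinEpi.one) :
    freeUnit X f ≫ freeMap X g = freeUnit X (g ≫ f) :=
  freeInc_desc _ _ _

/-- The diagram of all expressions. -/
noncomputable abbrev freeDiagram : FinEpiᵒᵖ ⥤ M where
  obj n := freeObj X n.unop
  map f := freeMap X f.unop
  -- Every constructor carries a surjection, so the action only composes at the root of an
  -- expression and is strictly functorial.
  map_id n := by apply freeObj_hom_ext <;> simp
  map_comp f g := by apply freeObj_hom_ext <;> simp [← Category.assoc]

variable {X} {A : LaxData M}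

section

variable (x : ∀ n, X n ⟶ A.obj n)

/-- The evaluation of all expressions in a lax datum. -/
noncomputable def freeEval (n : FinEpi) : freeObj X n ⟶ A.obj n :=
  freeDesc X fun t : Tree n => t.eval x

@[simp]
lemma freeLeaf_eval {n m : FinEpi} (f : n ⟶ m) : freeLeaf X f ≫ freeEval x n = x m ≫ A.map f :=
  freeInc_desc _ _ _

@[simp]
lemma freeNode_eval {n a b : FinEpi} (f : n ⟶ FinEpi.add a b) (s : Tree a) (t : Tree b) :
    freeNode X f s t ≫ freeEval x n = (s.eval x ⊗ₘ t.eval x) ≫ A.lax a b ≫ A.map f :=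
  freeInc_desc _ _ _

@[simp]
lemma freeUnit_eval {n : FinEpi} (f : n ⟶ FinEpi.one) :
    freeUnit X f ≫ freeEval x n = A.unit ≫ A.map f :=
  freeInc_desc _ _ _

lemma freeMap_eval {n m : FinEpi} (f : n ⟶ m) :
    freeMap X f ≫ freeEval x n = freeEval x m ≫ A.map f := by
  apply freeObj_hom_ext
  · intro k g
    rw [← Category.assoc, freeLeaf_map, freeLeaf_eval, ← Category.assoc, freeLeaf_eval]
    simp
  · intro a b g s t
    rw [← Category.assoc, freeNode_map, freeNode_eval, ← Category.assoc (freeNode X g s t),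
      freeNode_eval]
    simp
  · intro g
    rw [← Category.assoc, freeUnit_map, freeUnit_eval, ← Category.assoc, freeUnit_eval]
    simp

end

variable [SymmetricCategory M] [MonoidalClosed M] (X)

/-- The laxity maps of the free lax datum. -/
noncomputable def freeLax (a b : FinEpi) :
    freeObj X a ⊗ freeObj X b ⟶ freeObj X (FinEpi.add a b) :=
  sigmaTensorDesc fun s t => freeNode X (𝟙 _) s t

@[simp]
lemma freeInc_lax {a b : FinEpi} (s : Tree a) (t : Tree b) :
    (freeInc X s ⊗ₘ freeInc X t) ≫ freeLax X a b = freeNode X (𝟙 _) s t :=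
  tensorHom_sigmaTensorDesc _ _ _

variable {X} in
lemma freeTensor_hom_ext {a b : FinEpi} {Z : M} {p q : freeObj X a ⊗ freeObj X b ⟶ Z}
    (h : ∀ (s : Tree a) (t : Tree b),
      (freeInc X s ⊗ₘ freeInc X t) ≫ p = (freeInc X s ⊗ₘ freeInc X t) ≫ q) : p = q :=
  sigmaTensor_hom_ext h

/-- The free lax datum on a family of objects. -/
noncomputable abbrev free : LaxData M where
  diagram := freeDiagram X
  lax := freeLax X
  unit := freeUnit X (𝟙 _)

/-- The inclusion of the generators. -/
noncomputable def freeι (n : FinEpi) : X n ⟶ (free X).obj n := freeLeaf X (𝟙 n)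

variable {X}

section

variable {n : FinEpi} (p : free X ⟶ A)

lemma freeLeaf_app {m : FinEpi} (f : n ⟶ m) :
    freeLeaf X f ≫ Hom.app p n = (freeι X m ≫ Hom.app p m) ≫ A.map f := by
  have h : freeMap X f ≫ Hom.app p n = _ := Hom.map_app p f
  rw [Category.assoc, ← h]
  simp [freeι, ← Category.assoc]

lemma freeNode_app {a b : FinEpi} (f : n ⟶ FinEpi.add a b) (s : Tree a) (t : Tree b) :
    freeNode X f s t ≫ Hom.app p n =
      ((freeInc X s ≫ Hom.app p a) ⊗ₘ (freeInc X t ≫ Hom.app p b)) ≫ A.lax a b ≫ A.map f := by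
  have h₁ : freeMap X f ≫ Hom.app p n = _ := Hom.map_app p f
  have h₂ : freeLax X a b ≫ Hom.app p (FinEpi.add a b) = _ := Hom.lax_app p a b
  rw [← tensorHom_comp_tensorHom, Category.assoc, ← Category.assoc _ _ (A.map f), ← h₂,
    Category.assoc, ← h₁, ← Category.assoc, freeInc_lax]
  simp [← Category.assoc]

lemma freeUnit_app (f : n ⟶ FinEpi.one) :
    freeUnit X f ≫ Hom.app p n = A.unit ≫ A.map f := by
  have h₁ : freeMap X f ≫ Hom.app p n = _ := Hom.map_app p f
  have h₂ := Hom.unit_app p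
  rw [← h₂, Category.assoc, ← h₁]
  simp [← Category.assoc]

end

/-- Induction on expressions: a morphism commutes with surjections, laxity maps and the unit, so its
values on subexpressions determine its value on the whole, down to the generators at the leaves. -/
lemma free_hom_ext {p q : free X ⟶ A}
    (h : ∀ n, freeι X n ≫ Hom.app p n = freeι X n ≫ Hom.app q n) : p = q := by
  have key : ∀ {n} (t : Tree n), freeInc X t ≫ Hom.app p n = freeInc X t ≫ Hom.app q n := by
    intro n t
    induction t with
    | leaf f =>
      refine (freeLeaf_app p f).trans (Eq.trans ?_ (freeLeaf_app q f).symm)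
      rw [h]
    | node f s t hs ht =>
      refine (freeNode_app p f s t).trans (Eq.trans ?_ (freeNode_app q f s t).symm)
      rw [hs, ht]
    | unit f => exact (freeUnit_app p f).trans (freeUnit_app q f).symm
  ext n
  exact Limits.Sigma.hom_ext _ _ key

section

variable (x : ∀ n, X n ⟶ A.obj n)

lemma freeLax_eval (a b : FinEpi) :
    freeLax X a b ≫ freeEval x (FinEpi.add a b) =
      (freeEval x a ⊗ₘ freeEval x b) ≫ A.lax a b := by
  refine freeTensor_hom_ext fun s t => ?_
  rw [← Category.assoc, freeInc_lax, freeNode_eval, tensorHom_comp_tensorHom_assoc, freeEval,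
    freeEval, freeInc_desc, freeInc_desc]
  simp

/-- The morphism from a free lax datum which extends a family of maps. -/
noncomputable def freeLift : free X ⟶ A :=
  homMk (freeEval x) (freeMap_eval x) (freeLax_eval x) (by simp)

@[simp]
lemma freeι_freeLift (n : FinEpi) : freeι X n ≫ Hom.app (freeLift x) n = x n := by
  rw [freeι, freeLift, homMk_app, freeLeaf_eval]
  simp

end

end LaxData

/-! ### Quotients of lax data by relations -/

variable {M : Type u} [Category.{v} M] [MonoidalCategory M] [SymmetricCategory M] [MonoidalClosed M]

/-- Tensor products of reflexive coequalizers: inserting a section in one variable turns the joint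
hypothesis into a separate one in the other variable. One then descends in one variable at a time,
since tensoring with an object preserves coequalizers. -/
lemma exists_tensor_desc {A B Q A' B' Q' Z : M} {f g : B ⟶ A} {π : A ⟶ Q} {w : f ≫ π = g ≫ π}
    (hπ : IsColimit (Cofork.ofπ π w)) {f' g' : B' ⟶ A'} {π' : A' ⟶ Q'} {w' : f' ≫ π' = g' ≫ π'}
    (hπ' : IsColimit (Cofork.ofπ π' w')) (s : A ⟶ B) (hf : s ≫ f = 𝟙 _) (hg : s ≫ g = 𝟙 _)
    (s' : A' ⟶ B') (hf' : s' ≫ f' = 𝟙 _) (hg' : s' ≫ g' = 𝟙 _) (h : A ⊗ A' ⟶ Z)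
    (hh : (f ⊗ₘ f') ≫ h = (g ⊗ₘ g') ≫ h) : ∃ k : Q ⊗ Q' ⟶ Z, (π ⊗ₘ π') ≫ k = h := by
  have h₁ : f ▷ A' ≫ h = g ▷ A' ≫ h := by
    have e := B ◁ s' ≫= hh
    rw [← id_tensorHom, tensorHom_comp_tensorHom_assoc, tensorHom_comp_tensorHom_assoc, hf', hg']
      at e
    simpa using e
  have h₂ : A ◁ f' ≫ h = A ◁ g' ≫ h := by
    have e := s ▷ B' ≫= hh
    rw [← tensorHom_id, tensorHom_comp_tensorHom_assoc, tensorHom_comp_tensorHom_assoc, hf, hg]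
      at e
    simpa using e
  obtain ⟨k₁, hk₁⟩ : ∃ k₁ : Q ⊗ A' ⟶ Z, π ▷ A' ≫ k₁ = h :=
    ⟨_, (Cofork.IsColimit.desc' (isColimitCoforkMapOfIsColimit (tensorRight A') w hπ) h h₁).2⟩
  have : Epi π := epi_of_isColimit_cofork hπ
  have : Epi (π ▷ B') := by
    rw [← tensorHom_id]
    exact epi_tensorHom _ _
  have h₃ : Q ◁ f' ≫ k₁ = Q ◁ g' ≫ k₁ := by
    rw [← cancel_epi (π ▷ B'), ← whisker_exchange_assoc, ← whisker_exchange_assoc, hk₁, h₂]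
  obtain ⟨k, hk⟩ : ∃ k : Q ⊗ Q' ⟶ Z, Q ◁ π' ≫ k = k₁ :=
    ⟨_, (Cofork.IsColimit.desc' (isColimitCoforkMapOfIsColimit (tensorLeft Q) w' hπ') k₁ h₃).2⟩
  exact ⟨k, by rw [MonoidalCategory.tensorHom_def, Category.assoc, hk, hk₁]⟩

namespace LaxData

variable [HasColimits M]

/-- The coequalizer of the underlying diagrams inherits laxity maps through `exists_tensor_desc`.
That lemma is applied level by level, so the sections `s n` need not be natural nor compatible with
the operations. -/
theorem exists_coequalizer {A B : LaxData M} (d₀ d₁ : B ⟶ A) (s : ∀ n, A.obj n ⟶ B.obj n)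
    (h₀ : ∀ n, s n ≫ Hom.app d₀ n = 𝟙 _) (h₁ : ∀ n, s n ≫ Hom.app d₁ n = 𝟙 _) :
    ∃ (Q : LaxData M) (π : A ⟶ Q), (∀ n, Epi (Hom.app π n)) ∧ d₀ ≫ π = d₁ ≫ π ∧
      ∀ {Z : LaxData M} (k : A ⟶ Z), d₀ ≫ k = d₁ ≫ k → ∃ l : Q ⟶ Z, π ≫ l = k := by
  let p := coequalizer.π (Hom.nat d₀) (Hom.nat d₁)
  have hp := coequalizer.condition (Hom.nat d₀) (Hom.nat d₁)
  have hc (n : FinEpi) : IsColimit (Cofork.ofπ (f := Hom.app d₀ n) (g := Hom.app d₁ n)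
      (p.app (op n)) (NatTrans.congr_app hp (op n))) :=
    isColimitCoforkMapOfIsColimit ((evaluation FinEpiᵒᵖ M).obj (op n)) hp
      (coequalizerIsCoequalizer (Hom.nat d₀) (Hom.nat d₁))
  have hw (n : FinEpi) : Hom.app d₀ n ≫ p.app (op n) = Hom.app d₁ n ≫ p.app (op n) :=
    NatTrans.congr_app hp (op n)
  have hepi (n : FinEpi) : Epi (p.app (op n)) := epi_of_isColimit_cofork (hc n)
  choose lax hlax using fun n m => exists_tensor_desc (hc n) (hc m) (s n) (h₀ n) (h₁ n) (s m)
    (h₀ m) (h₁ m) (A.lax n m ≫ p.app (op (FinEpi.add n m))) (by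
      rw [← reassoc_of% (Hom.lax_app d₀ n m), ← reassoc_of% (Hom.lax_app d₁ n m), hw])
  let Q : LaxData M :=
    { diagram := coequalizer (Hom.nat d₀) (Hom.nat d₁)
      lax := lax
      unit := A.unit ≫ p.app (op FinEpi.one) }
  let π : A ⟶ Q :=
    { nat := p
      nat_lax n m := (hlax n m).symm
      nat_unit := rfl }
  refine ⟨Q, π, hepi, hom_ext hw, fun {Z} k hk => ?_⟩
  have hk' : Hom.nat d₀ ≫ Hom.nat k = Hom.nat d₁ ≫ Hom.nat k := congr_arg Hom.nat hk
  let l := coequalizer.desc (Hom.nat k) hk'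
  have hl : p ≫ l = Hom.nat k := coequalizer.π_desc _ _
  have hl' (n : FinEpi) : p.app (op n) ≫ l.app (op n) = Hom.app k n :=
    NatTrans.congr_app hl (op n)
  refine ⟨{ nat := l, nat_lax := fun n m => ?_, nat_unit := ?_ }, Hom.ext hl⟩
  · have := epi_tensorHom (p.app (op n)) (p.app (op m))
    have e := hlax n m
    rw [← cancel_epi (p.app (op n) ⊗ₘ p.app (op m)), reassoc_of% e,
      tensorHom_comp_tensorHom_assoc, hl', hl', hl']
    exact Hom.lax_app k n m
  · change (A.unit ≫ p.app (op FinEpi.one)) ≫ _ = _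
    rw [Category.assoc, hl']
    exact Hom.unit_app k

/-- The quotient of a lax datum by a family of relations. -/
theorem exists_quotient (A : LaxData M) {ι : Type v} (lev : ι → FinEpi) (R : ι → M)
    (r₁ r₂ : ∀ i, R i ⟶ A.obj (lev i)) :
    ∃ (Q : LaxData M) (π : A ⟶ Q), (∀ n, Epi (Hom.app π n)) ∧
      (∀ i, r₁ i ≫ Hom.app π (lev i) = r₂ i ≫ Hom.app π (lev i)) ∧
      ∀ {Z : LaxData M} (k : A ⟶ Z),
        (∀ i, r₁ i ≫ Hom.app k (lev i) = r₂ i ≫ Hom.app k (lev i)) → ∃ l : Q ⟶ Z, π ≫ l = k := by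
  -- `S n` collects the relations pulled back along all surjections `n ⟶ lev i`. The extra summand
  -- `A.obj n` of `X n`, on which both maps are the identity, makes the pair of free lifts reflexive
  -- at each level.
  let S (n : FinEpi) : M := ∐ fun p : Σ i, n ⟶ lev i => R p.1
  let X (n : FinEpi) : M := A.obj n ⨿ S n
  let a (n : FinEpi) : A.obj n ⟶ X n := coprod.inl
  let b {n : FinEpi} (p : Σ i, n ⟶ lev i) : R p.1 ⟶ X n :=
    Limits.Sigma.ι (fun p : Σ i, n ⟶ lev i => R p.1) p ≫ coprod.inr
  have hX {n : FinEpi} {Z : M} {x y : X n ⟶ Z} (h : a n ≫ x = a n ≫ y)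
      (h' : ∀ p, b p ≫ x = b p ≫ y) : x = y :=
    coprod.hom_ext h (Limits.Sigma.hom_ext _ _ fun p => by simpa [b] using h' p)
  let t (r : ∀ i, R i ⟶ A.obj (lev i)) (n : FinEpi) : X n ⟶ A.obj n :=
    coprod.desc (𝟙 _) (Limits.Sigma.desc fun p => r p.1 ≫ A.map p.2)
  have ha (r) (n : FinEpi) : a n ≫ t r n = 𝟙 _ := coprod.inl_desc _ _
  have hb (r) {n : FinEpi} (p : Σ i, n ⟶ lev i) : b p ≫ t r n = r p.1 ≫ A.map p.2 := by
    refine (Category.assoc _ _ _).trans ((_ ≫= coprod.inr_desc _ _).trans (Limits.Sigma.ι_desc _ _))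
  clear_value t b a
  obtain ⟨Q, π, h₁, h₂, h₃⟩ := exists_coequalizer (freeLift (t r₁)) (freeLift (t r₂))
    (fun n => a n ≫ freeι X n) (fun n => by simp [ha]) (fun n => by simp [ha])
  have key {Z : LaxData M} (k : A ⟶ Z) : freeLift (t r₁) ≫ k = freeLift (t r₂) ≫ k ↔
      ∀ i, r₁ i ≫ Hom.app k (lev i) = r₂ i ≫ Hom.app k (lev i) := by
    constructor
    · intro h i
      have h' := freeι X (lev i) ≫= congr_arg (fun φ => Hom.app φ (lev i)) h
      simp only [comp_app, ← Category.assoc, freeι_freeLift] at h'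
      have h'' := b ⟨i, 𝟙 _⟩ ≫= h'
      simpa only [← Category.assoc, hb, map_id, Category.comp_id] using h''
    · intro h
      refine free_hom_ext fun n => ?_
      simp only [comp_app, ← Category.assoc, freeι_freeLift]
      refine hX (by simp only [← Category.assoc, ha]) fun p => ?_
      simp only [← Category.assoc, hb]
      simp only [Category.assoc, Hom.map_app, reassoc_of% h]
  exact ⟨Q, π, h₁, (key π).1 h₂, fun k hk => h₃ k ((key k).2 hk)⟩

end LaxData

/-! ### The axioms as relations, and presentations of premonoids -/

variable {M : Type u} [Category.{v} M] [MonoidalCategory M]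

/-- The indices of the identities which a lax datum has to satisfy in order to be a commutative
premonoid. -/
inductive Law : Type
  | natural {n n' m m' : FinEpi} (f : n' ⟶ n) (g : m' ⟶ m) : Law
  | assoc (n m k : FinEpi) : Law
  | symm (n m : FinEpi) : Law
  | unit : Law

namespace Law

/-- The first summand of the finite set over which an identity takes place. -/
def left : Law → FinEpi
  | natural (n' := n') _ _ => n'
  | assoc n m _ => FinEpi.add n m
  | symm _ m => m
  | unit => FinEpi.one

/-- The second summand of the finite set over which an identity takes place. -/
def right : Law → FinEpi
  | natural (m' := m') _ _ => m'
  | assoc _ _ k => k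
  | symm n _ => n
  | unit => FinEpi.one

/-- The finite set over which an identity takes place. -/
abbrev lev (l : Law) : FinEpi := FinEpi.add l.left l.right

/-- The source of the two sides of an identity. -/
def src (A : LaxData M) : Law → M
  | natural (n := n) (m := m) _ _ => A.obj n ⊗ A.obj m
  | assoc n m k => (A.obj n ⊗ A.obj m) ⊗ A.obj k
  | symm n m => A.obj n ⊗ A.obj m
  | unit => 𝟙_ M ⊗ A.obj FinEpi.one

/-- The left hand side of an identity. -/
def lhs (A : LaxData M) : (l : Law) → (l.src A ⟶ A.obj l.lev)
  | natural (n' := n') (m' := m') f g => (A.map f ⊗ₘ A.map g) ≫ A.lax n' m'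
  | assoc n m k => (A.lax n m ▷ A.obj k) ≫ A.lax (FinEpi.add n m) k
  | symm n m => A.lax n m ≫ A.map (FinEpi.swap m n)
  | unit => (A.unit ▷ A.obj FinEpi.one) ≫ A.lax FinEpi.one FinEpi.one

variable {A B : LaxData M} (k : A ⟶ B)

/-- The functoriality of the source of the two sides of an identity. -/
def srcMap : (l : Law) → (l.src A ⟶ l.src B)
  | natural (n := n) (m := m) _ _ => LaxData.Hom.app k n ⊗ₘ LaxData.Hom.app k m
  | assoc n m p => (LaxData.Hom.app k n ⊗ₘ LaxData.Hom.app k m) ⊗ₘ LaxData.Hom.app k p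
  | symm n m => LaxData.Hom.app k n ⊗ₘ LaxData.Hom.app k m
  | unit => 𝟙 _ ⊗ₘ LaxData.Hom.app k FinEpi.one

/-- Both sides of each axiom are natural in the lax datum. This lets the axioms pass to quotients,
by cancelling an epimorphism, and to limits, by cancelling a jointly monic family. -/
lemma lhs_app (l : Law) : l.lhs A ≫ LaxData.Hom.app k l.lev = l.srcMap k ≫ l.lhs B := by
  cases l with
  | natural f g =>
    dsimp only [lhs, src, srcMap, lev, left, right]
    rw [Category.assoc, LaxData.Hom.lax_app, tensorHom_comp_tensorHom_assoc,
      tensorHom_comp_tensorHom_assoc, LaxData.Hom.map_app, LaxData.Hom.map_app]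
  | assoc n m p =>
    dsimp only [lhs, src, srcMap, lev, left, right]
    rw [Category.assoc, LaxData.Hom.lax_app, ← tensorHom_id, ← tensorHom_id,
      tensorHom_comp_tensorHom_assoc, tensorHom_comp_tensorHom_assoc, LaxData.Hom.lax_app,
      Category.id_comp, Category.comp_id]
  | symm n m =>
    dsimp only [lhs, src, srcMap, lev, left, right]
    rw [Category.assoc, LaxData.Hom.map_app, reassoc_of% (LaxData.Hom.lax_app k n m)]
  | unit =>
    dsimp only [lhs, src, srcMap, lev, left, right]
    rw [Category.assoc, LaxData.Hom.lax_app, ← tensorHom_id, ← tensorHom_id,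
      tensorHom_comp_tensorHom_assoc, tensorHom_comp_tensorHom_assoc, LaxData.Hom.unit_app,
      Category.id_comp, Category.id_comp, Category.comp_id]

variable [SymmetricCategory M]

/-- The right hand side of an identity. -/
def rhs (A : LaxData M) : (l : Law) → (l.src A ⟶ A.obj l.lev)
  | natural (n := n) (m := m) f g => A.lax n m ≫ A.map (FinEpi.sum f g)
  | assoc n m k => (α_ (A.obj n) (A.obj m) (A.obj k)).hom ≫ (A.obj n ◁ A.lax m k) ≫
      A.lax n (FinEpi.add m k) ≫ A.map (FinEpi.assoc n m k)
  | symm n m => (β_ (A.obj n) (A.obj m)).hom ≫ A.lax m n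
  | unit => (λ_ (A.obj FinEpi.one)).hom ≫ A.map (FinEpi.toOne (FinEpi.add FinEpi.one FinEpi.one))

lemma rhs_app (l : Law) : l.rhs A ≫ LaxData.Hom.app k l.lev = l.srcMap k ≫ l.rhs B := by
  cases l with
  | natural f g =>
    dsimp only [rhs, src, srcMap, lev, left, right]
    rw [Category.assoc, LaxData.Hom.map_app, reassoc_of% (LaxData.Hom.lax_app k)]
  | assoc n m p =>
    dsimp only [rhs, src, srcMap, lev, left, right]
    rw [Category.assoc, Category.assoc, Category.assoc, LaxData.Hom.map_app,
      reassoc_of% (LaxData.Hom.lax_app k), ← id_tensorHom, ← id_tensorHom,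
      tensorHom_comp_tensorHom_assoc, associator_naturality_assoc, tensorHom_comp_tensorHom_assoc,
      LaxData.Hom.lax_app, Category.id_comp, Category.comp_id]
  | symm n m =>
    dsimp only [rhs, src, srcMap, lev, left, right]
    rw [Category.assoc, LaxData.Hom.lax_app, BraidedCategory.braiding_naturality_assoc]
  | unit =>
    dsimp only [rhs, src, srcMap, lev, left, right]
    rw [Category.assoc, LaxData.Hom.map_app, id_tensorHom, leftUnitor_naturality_assoc]

/-- Needed to pass from axioms that hold for elements coming from a lax datum to axioms that hold in
its quotient. -/
lemma epi_srcMap [MonoidalClosed M] (hk : ∀ n, Epi (LaxData.Hom.app k n)) (l : Law) :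
    Epi (l.srcMap k) := by
  cases l with
  | natural f g => exact epi_tensorHom _ _
  | assoc n m p =>
    have := epi_tensorHom (LaxData.Hom.app k n) (LaxData.Hom.app k m)
    exact epi_tensorHom _ _
  | symm n m => exact epi_tensorHom _ _
  | unit => exact epi_tensorHom _ _

end Law

variable [SymmetricCategory M]

/-- The condition that a lax datum is a commutative premonoid. -/
def LaxData.IsPremonoid (A : LaxData M) : Prop := ∀ l : Law, l.lhs A = l.rhs A

/-- A lax datum which satisfies all the required identities is a commutative premonoid. -/
def LaxData.IsPremonoid.toCommPremonoid {A : LaxData M} (h : A.IsPremonoid) : CommPremonoid M where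
  diagram := A.diagram
  lax := A.lax
  lax_natural f g := h (.natural f g)
  lax_assoc n m k := h (.assoc n m k)
  lax_symm n m := h (.symm n m)
  unit := A.unit
  unit_lax := h .unit

namespace CommPremonoid

variable (M) in
/-- The functor which forgets the identities satisfied by a commutative premonoid. -/
def toLaxData : CommPremonoid M ⥤ LaxData M where
  obj F := { diagram := F.diagram, lax := F.lax, unit := F.unit }
  map σ := { nat := Hom.nat σ, nat_lax := Hom.nat_lax σ, nat_unit := Hom.nat_unit σ }

lemma isPremonoid (F : CommPremonoid M) : ((toLaxData M).obj F).IsPremonoid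
  | .natural f g => F.lax_natural f g
  | .assoc n m k => F.lax_assoc n m k
  | .symm n m => F.lax_symm n m
  | .unit => F.unit_lax

/-- The forgetful functor from commutative premonoids to lax data is fully faithful. -/
def fullyFaithfulToLaxData : (toLaxData M).FullyFaithful where
  preimage σ :=
    { nat := LaxData.Hom.nat σ
      nat_lax := LaxData.Hom.nat_lax σ
      nat_unit := LaxData.Hom.nat_unit σ }

instance : (toLaxData M).Full := fullyFaithfulToLaxData.full

instance : (toLaxData M).Faithful := fullyFaithfulToLaxData.faithful

variable [MonoidalClosed M] [HasColimits M]

/-- Commutative premonoids can be defined by generators and relations. -/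
theorem exists_presentation (X : FinEpi → M) {ι : Type v} (lev : ι → FinEpi) (R : ι → M)
    (r₁ r₂ : ∀ i, R i ⟶ (LaxData.free X).obj (lev i)) :
    ∃ (Q : CommPremonoid M) (x : ∀ n, X n ⟶ ((toLaxData M).obj Q).obj n),
      (∀ i, r₁ i ≫ LaxData.Hom.app (LaxData.freeLift x) (lev i) =
        r₂ i ≫ LaxData.Hom.app (LaxData.freeLift x) (lev i)) ∧
      ∀ {Z : CommPremonoid M} (z : ∀ n, X n ⟶ ((toLaxData M).obj Z).obj n),
        (∀ i, r₁ i ≫ LaxData.Hom.app (LaxData.freeLift z) (lev i) =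
          r₂ i ≫ LaxData.Hom.app (LaxData.freeLift z) (lev i)) →
        ∃! l : Q ⟶ Z, ∀ n, x n ≫ LaxData.Hom.app ((toLaxData M).map l) n = z n := by
  let A := LaxData.free X
  -- The axioms of the free datum are imposed along with the given relations. They cost nothing in
  -- the universal property, since every premonoid satisfies them.
  obtain ⟨Q, π, h₁, h₂, h₃⟩ := LaxData.exists_quotient A (ι := ι ⊕ ULift.{v} Law)
    (Sum.elim lev fun l => l.down.lev) (Sum.elim R fun l => l.down.src A)
    (fun | .inl i => r₁ i | .inr l => l.down.lhs A)
    (fun | .inl i => r₂ i | .inr l => l.down.rhs A)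
  have hQ : Q.IsPremonoid := fun l => by
    have := Law.epi_srcMap π h₁ l
    rw [← cancel_epi (l.srcMap π), ← Law.lhs_app, ← Law.rhs_app]
    exact h₂ (.inr ⟨l⟩)
  let x (n : FinEpi) : X n ⟶ Q.obj n := LaxData.freeι X n ≫ LaxData.Hom.app π n
  have hx : LaxData.freeLift x = π := LaxData.free_hom_ext fun n => by simp [x]
  refine ⟨hQ.toCommPremonoid, x, fun i => ?_, fun {Z} z hz => ?_⟩
  · have := h₂ (.inl i)
    rw [← hx] at this
    exact this
  · obtain ⟨l, hl⟩ := h₃ (LaxData.freeLift z) (by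
      rintro (i | l)
      · exact hz i
      · refine (Law.lhs_app _ _).trans (Eq.trans ?_ (Law.rhs_app _ _).symm)
        rw [Z.isPremonoid])
    refine ⟨fullyFaithfulToLaxData.preimage l, fun n => ?_, fun l' hl' => ?_⟩
    · have := LaxData.freeι_freeLift (A := (toLaxData M).obj Z) z n
      rw [← hl] at this
      exact (Category.assoc _ _ _).trans this
    · have H : π ≫ (toLaxData M).map l' = π ≫ l := by
        rw [hl]
        refine LaxData.free_hom_ext fun n => ?_
        rw [LaxData.freeι_freeLift, ← hl' n]
        exact (Category.assoc _ _ _).symm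
      refine (toLaxData M).map_injective (LaxData.hom_ext fun n => ?_)
      have := h₁ n
      exact (cancel_epi (LaxData.Hom.app π n)).1 (congr_arg (fun φ => LaxData.Hom.app φ n) H)

end CommPremonoid

/-! ### Tensor products of sifted colimits -/

section

variable {M : Type u} [Category.{v} M] [MonoidalCategory M] [SymmetricCategory M] [MonoidalClosed M]
  {J : Type*} [Category* J] {K L N : J ⥤ M} {c : Cocone K} {d : Cocone L} {e : Cocone N}

section

variable [IsSifted J] (hc : IsColimit c) (hd : IsColimit d) (he : IsColimit e)

include hc hd

/-- The tensor product preserves colimits in each variable, and the diagonal of a sifted category is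
final, so `c.pt ⊗ d.pt` is the colimit of the pointwise tensor product. -/
lemma exists_desc_tensor_of_isSifted {Z : M} (φ : ∀ j, K.obj j ⊗ L.obj j ⟶ Z)
    (hφ : ∀ {i j} (f : i ⟶ j), (K.map f ⊗ₘ L.map f) ≫ φ j = φ i) :
    ∃ k : c.pt ⊗ d.pt ⟶ Z, ∀ j, (c.ι.app j ⊗ₘ d.ι.app j) ≫ k = φ j := by
  let s : Cocone (K ⊗ L) :=
    { pt := Z
      ι := { app := φ, naturality _ _ f := (hφ f).trans (Category.comp_id _).symm } }
  exact ⟨(hc.tensor hd).desc s, (hc.tensor hd).fac s⟩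

lemma tensor_hom_ext_of_isSifted {Z : M} {p q : c.pt ⊗ d.pt ⟶ Z}
    (h : ∀ j, (c.ι.app j ⊗ₘ d.ι.app j) ≫ p = (c.ι.app j ⊗ₘ d.ι.app j) ≫ q) : p = q :=
  (hc.tensor hd).hom_ext h

include he

lemma tensor₃_hom_ext_of_isSifted {Z : M} {p q : (c.pt ⊗ d.pt) ⊗ e.pt ⟶ Z}
    (h : ∀ j, ((c.ι.app j ⊗ₘ d.ι.app j) ⊗ₘ e.ι.app j) ≫ p =
      ((c.ι.app j ⊗ₘ d.ι.app j) ⊗ₘ e.ι.app j) ≫ q) : p = q :=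
  ((hc.tensor hd).tensor he).hom_ext h

end

end

/-! ### The left adjoint of the forgetful functor, and colimits of premonoids -/

namespace LaxData

section

variable {M : Type u} [Category.{v} M] [MonoidalCategory M] [SymmetricCategory M] [MonoidalClosed M]
  [HasColimits M]

lemma freeLift_comp {X : FinEpi → M} {A B : LaxData M} (x : ∀ n, X n ⟶ A.obj n) (k : A ⟶ B) :
    freeLift x ≫ k = freeLift fun n => x n ≫ Hom.app k n :=
  free_hom_ext fun n => by
    rw [comp_app, ← Category.assoc, freeι_freeLift, freeι_freeLift]

/-- A family of maps between lax data which is compatible with the evaluation of all expressions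
is a morphism. -/
lemma exists_hom_of_counit {A B : LaxData M} (w : ∀ n, A.obj n ⟶ B.obj n)
    (h : ∀ n, Hom.app (freeLift w) n = Hom.app (freeLift (X := A.obj) fun _ => 𝟙 _) n ≫ w n) :
    ∃ k : A ⟶ B, ∀ n, Hom.app k n = w n := by
  let ε := freeLift (X := A.obj) (A := A) fun _ => 𝟙 _
  have hε (n : FinEpi) : freeι A.obj n ≫ Hom.app ε n = 𝟙 _ := freeι_freeLift _ n
  have hε' (n : FinEpi) : Hom.app ε n ≫ w n = Hom.app (freeLift w) n := (h n).symm
  refine ⟨homMk w (fun {n m} f => ?_) (fun n m => ?_) ?_, fun n => rfl⟩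
  · have e : A.map f = (freeι A.obj m ≫ (free A.obj).map f) ≫ Hom.app ε n := by
      rw [Category.assoc, Hom.map_app, ← Category.assoc, hε, Category.id_comp]
    rw [e, Category.assoc, hε', Category.assoc, Hom.map_app, ← Category.assoc, freeι_freeLift]
  · have e : A.lax n m = ((freeι A.obj n ⊗ₘ freeι A.obj m) ≫ (free A.obj).lax n m) ≫
        Hom.app ε (FinEpi.add n m) := by
      rw [Category.assoc, Hom.lax_app, tensorHom_comp_tensorHom_assoc, hε, hε]
      simp
    rw [e, Category.assoc, hε', Category.assoc, Hom.lax_app, tensorHom_comp_tensorHom_assoc,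
      freeι_freeLift, freeι_freeLift]
  · have e : A.unit = (free A.obj).unit ≫ Hom.app ε FinEpi.one := (Hom.unit_app ε).symm
    rw [e, Category.assoc, hε', Hom.unit_app]

end

end LaxData

namespace CommPremonoid

variable {M : Type u} [Category.{v} M] [MonoidalCategory M] [SymmetricCategory M]

/-- The components of a morphism of commutative premonoids. -/
abbrev Hom.app {F G : CommPremonoid M} (σ : F ⟶ G) (n : FinEpi) :
    ((toLaxData M).obj F).obj n ⟶ ((toLaxData M).obj G).obj n :=
  LaxData.Hom.app ((toLaxData M).map σ) n

lemma hom_ext {F G : CommPremonoid M} {σ τ : F ⟶ G} (h : ∀ n, Hom.app σ n = Hom.app τ n) :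
    σ = τ :=
  (toLaxData M).map_injective (LaxData.hom_ext h)

lemma comp_app {F G H : CommPremonoid M} (σ : F ⟶ G) (τ : G ⟶ H) (n : FinEpi) :
    Hom.app (σ ≫ τ) n = Hom.app σ n ≫ Hom.app τ n := rfl

lemma exists_levelwise_colimit [HasColimits M] {J : Type v} [SmallCategory J] (F : J ⥤ CommPremonoid M) :
    ∃ (X : FinEpi → M) (w : ∀ j n, ((toLaxData M).obj (F.obj j)).obj n ⟶ X n),
      (∀ {i j} (f : i ⟶ j) n, Hom.app (F.map f) n ≫ w j n = w i n) ∧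
      (∀ n {Y : M} (p q : X n ⟶ Y), (∀ j, w j n ≫ p = w j n ≫ q) → p = q) ∧
      ∀ t : Cocone F, ∃ z : ∀ n, X n ⟶ ((toLaxData M).obj t.pt).obj n,
        ∀ j n, w j n ≫ z n = Hom.app (t.ι.app j) n := by
  let c := colimit.cocone (F ⋙ forget M)
  exact ⟨fun n => c.pt.obj (op n), fun j n => (c.ι.app j).app (op n),
    fun f n => NatTrans.congr_app (c.w f) (op n),
    fun n Y p q h => (isColimitOfPreserves ((evaluation FinEpiᵒᵖ M).obj (op n))
      (colimit.isColimit (F ⋙ forget M))).hom_ext h,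
    fun t => ⟨fun n => (colimit.desc _ ((forget M).mapCocone t)).app (op n), fun j n =>
      NatTrans.congr_app (colimit.ι_desc ((forget M).mapCocone t) j) (op n)⟩⟩

section

variable [MonoidalClosed M] [HasColimits M]

/-- The free premonoid on a diagram `X` has generators `X(n)`, with relations identifying the formal
action of each surjection on a generator with its action in `X`. -/
instance isRightAdjoint_forget : (forget M).IsRightAdjoint := by
  have (X : FinEpiᵒᵖ ⥤ M) : HasInitial (StructuredArrow X (forget M)) := by
    obtain ⟨Q, x, h₁, h₂⟩ := exists_presentation (M := M) (fun n => X.obj (op n))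
      (ι := ULift (Σ p : FinEpi × FinEpi, p.1 ⟶ p.2)) (fun i => i.down.1.1)
      (fun i => X.obj (op i.down.1.2)) (fun i => LaxData.freeLeaf (fun n => X.obj (op n)) i.down.2)
      (fun i => X.map i.down.2.op ≫ LaxData.freeι (fun n => X.obj (op n)) _)
    have key {Z : CommPremonoid M} (z : ∀ n, X.obj (op n) ⟶ ((toLaxData M).obj Z).obj n)
        {n m : FinEpi} (f : n ⟶ m) :
        (LaxData.freeLeaf (fun n => X.obj (op n)) f ≫ LaxData.Hom.app (LaxData.freeLift z) n =
        (X.map f.op ≫ LaxData.freeι (fun n => X.obj (op n)) n) ≫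
          LaxData.Hom.app (LaxData.freeLift z) n) ↔
        X.map f.op ≫ z n = z m ≫ Z.diagram.map f.op := by
      rw [Category.assoc, LaxData.freeι_freeLift, eq_comm]
      exact Eq.congr rfl (LaxData.freeLeaf_eval _ _)
    let y : X ⟶ (forget M).obj Q :=
      { app n := x n.unop
        naturality n m f := (key x f.unop).1 (h₁ ⟨⟨(m.unop, n.unop), f.unop⟩⟩) }
    have hu (Z : StructuredArrow X (forget M)) : ∃! l : Q ⟶ Z.right,
        ∀ n, x n ≫ Hom.app l n = Z.hom.app (op n) :=
      h₂ _ fun i => (key _ i.down.2).2 (Z.hom.naturality i.down.2.op)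
    exact (IsInitial.ofUniqueHom (X := StructuredArrow.mk y)
      (fun Z => StructuredArrow.homMk (hu Z).choose
        (NatTrans.ext (funext fun n => (hu Z).choose_spec.1 n.unop)))
      (fun Z m => StructuredArrow.hom_ext _ _ ((hu Z).choose_spec.2 _ fun n =>
        NatTrans.congr_app (StructuredArrow.w m) (op n)))).hasInitial
  exact isRightAdjointOfStructuredArrowInitials _

instance hasColimits : HasColimits (CommPremonoid M) where
  has_colimits_of_shape J _ := ⟨fun F => by
    obtain ⟨X, w, hw, hext, hdesc⟩ := exists_levelwise_colimit F
    let A (j : J) : LaxData M := (toLaxData M).obj (F.obj j)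
    -- The generators are the levelwise colimits. For each `j`, the relations identify an expression
    -- in `F(j)` carried over to generators with the generator of its value in `F(j)`; by
    -- `exists_hom_of_counit` this is what makes the coprojections morphisms.
    obtain ⟨Q, x, h₁, h₂⟩ := exists_presentation X (ι := J × ULift FinEpi) (fun i => i.2.down)
      (fun i => (LaxData.free (A i.1).obj).obj i.2.down)
      (fun i => LaxData.Hom.app (LaxData.freeLift fun n => w i.1 n ≫ LaxData.freeι X n) i.2.down)
      (fun i => LaxData.Hom.app (LaxData.freeLift (A := A i.1) fun _ => 𝟙 _) i.2.down ≫
        w i.1 i.2.down ≫ LaxData.freeι X i.2.down)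
    have key {Z : CommPremonoid M} (z : ∀ n, X n ⟶ ((toLaxData M).obj Z).obj n) (j n) :
        LaxData.Hom.app (LaxData.freeLift fun n => w j n ≫ LaxData.freeι X n) n ≫
          LaxData.Hom.app (LaxData.freeLift z) n =
        LaxData.Hom.app (LaxData.freeLift fun n => w j n ≫ z n) n := by
      rw [← LaxData.comp_app, LaxData.freeLift_comp]
      simp only [Category.assoc, LaxData.freeι_freeLift]
    choose k hk using fun j => LaxData.exists_hom_of_counit (fun n => w j n ≫ x n) fun n => by
      rw [← key]
      simpa using h₁ (j, ⟨n⟩)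
    let s : Cocone F :=
      { pt := Q
        ι :=
          { app j := fullyFaithfulToLaxData.preimage (k j)
            naturality i j f := hom_ext fun n => by
              refine (Hom.app (F.map f) n ≫= hk j n).trans ?_
              rw [← Category.assoc, hw, ← hk]
              exact (Category.comp_id _).symm } }
    have hs (j n) : Hom.app (s.ι.app j) n = w j n ≫ x n := hk j n
    choose z hz using hdesc
    have hu (t : Cocone F) : ∃! l : Q ⟶ t.pt, ∀ n, x n ≫ Hom.app l n = z t n := by
      refine h₂ _ fun i => ?_
      have e : LaxData.freeLift (fun n => w i.1 n ≫ z t n) =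
          LaxData.freeLift (A := A i.1) (fun _ => 𝟙 _) ≫ (toLaxData M).map (t.ι.app i.1) := by
        rw [LaxData.freeLift_comp]
        congr 1
        funext n
        rw [hz, Category.id_comp]
      rw [key, e, LaxData.comp_app, Category.assoc, Category.assoc, LaxData.freeι_freeLift, hz]
    exact ⟨⟨s,
      { desc t := (hu t).choose
        fac t j := hom_ext fun n => by
          rw [comp_app, hs, Category.assoc, (hu t).choose_spec.1 n, hz]
        uniq t m hm := (hu t).choose_spec.2 m fun n => hext n _ _ fun j => by
          rw [hz, ← hm, comp_app, hs, Category.assoc] }⟩⟩⟩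

end

end CommPremonoid

/-! ### Limits and sifted colimits are levelwise -/

variable {M : Type u} [Category.{v} M] [MonoidalCategory M]

namespace LaxData

lemma isIso_of_isIso_app {A B : LaxData M} (f : A ⟶ B) (h : ∀ n, IsIso (Hom.app f n)) :
    IsIso f := by
  refine ⟨homMk (fun n => inv (Hom.app f n)) (fun {n m} g => ?_) (fun n m => ?_) ?_,
    hom_ext fun n => IsIso.hom_inv_id (Hom.app f n),
    hom_ext fun n => IsIso.inv_hom_id (Hom.app f n)⟩
  · rw [IsIso.comp_inv_eq, Category.assoc, Hom.map_app, IsIso.inv_hom_id_assoc]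
  · rw [IsIso.comp_inv_eq, Category.assoc, Hom.lax_app, tensorHom_comp_tensorHom_assoc,
      IsIso.inv_hom_id, IsIso.inv_hom_id]
    simp
  · rw [IsIso.comp_inv_eq, Hom.unit_app]

end LaxData

variable [SymmetricCategory M]

namespace Law

variable {J : Type*} {A : J → LaxData M} {B : LaxData M}

/-- The form in which limits inherit the axioms: the projections from a limit are jointly monic at
each level. -/
lemma isPremonoid_of_mono (k : ∀ j, B ⟶ A j) (hA : ∀ j, (A j).IsPremonoid)
    (h : ∀ n {Z : M} (p q : Z ⟶ B.obj n),
      (∀ j, p ≫ LaxData.Hom.app (k j) n = q ≫ LaxData.Hom.app (k j) n) → p = q) :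
    B.IsPremonoid := fun l =>
  h _ _ _ fun j => by rw [lhs_app, rhs_app, hA]

end Law

namespace CommPremonoid

/-- Limits of commutative premonoids are computed levelwise. -/
instance hasLimitsOfShape (J : Type w) [Category J] [HasLimitsOfShape J M] :
    HasLimitsOfShape J (CommPremonoid M) := ⟨fun F => by
  let c := limit.cone (F ⋙ forget M)
  have hc (n : FinEpi) := isLimitOfPreserves ((evaluation FinEpiᵒᵖ M).obj (op n))
    (limit.isLimit (F ⋙ forget M))
  let p (j : J) (n : FinEpi) : c.pt.obj (op n) ⟶ ((toLaxData M).obj (F.obj j)).obj n :=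
    (c.π.app j).app (op n)
  have hp {i j} (f : i ⟶ j) (n : FinEpi) : p i n ≫ Hom.app (F.map f) n = p j n :=
    NatTrans.congr_app (c.w f) (op n)
  have hext (n : FinEpi) {Z : M} (a b : Z ⟶ c.pt.obj (op n)) (h : ∀ j, a ≫ p j n = b ≫ p j n) :
      a = b := (hc n).hom_ext h
  have hlift (n : FinEpi) {Z : M} (a : ∀ j, Z ⟶ ((toLaxData M).obj (F.obj j)).obj n)
      (ha : ∀ {i j} (f : i ⟶ j), a i ≫ Hom.app (F.map f) n = a j) :
      ∃ b : Z ⟶ c.pt.obj (op n), ∀ j, b ≫ p j n = a j :=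
    ⟨(hc n).lift ⟨Z, { app := a, naturality _ _ f := (Category.id_comp _).trans (ha f).symm }⟩,
      (hc n).fac _⟩
  choose lax hlax using fun n m => hlift (FinEpi.add n m)
    (fun j => (p j n ⊗ₘ p j m) ≫ ((toLaxData M).obj (F.obj j)).lax n m) (fun f => by
      rw [Category.assoc, LaxData.Hom.lax_app, tensorHom_comp_tensorHom_assoc, hp, hp])
  obtain ⟨unit, hunit⟩ := hlift FinEpi.one (fun j => ((toLaxData M).obj (F.obj j)).unit)
    (fun f => LaxData.Hom.unit_app _)
  let A : LaxData M := { diagram := c.pt, lax := lax, unit := unit }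
  let k (j : J) : A ⟶ (toLaxData M).obj (F.obj j) :=
    { nat := c.π.app j, nat_lax n m := hlax n m j, nat_unit := hunit j }
  have hA : A.IsPremonoid := Law.isPremonoid_of_mono k (fun j => (F.obj j).isPremonoid) hext
  let s : Cone F :=
    { pt := hA.toCommPremonoid
      π :=
        { app j := fullyFaithfulToLaxData.preimage (k j)
          naturality i j f := hom_ext fun n =>
            (Category.id_comp _).trans (hp f n).symm } }
  choose l hl using fun (t : Cone F) (n : FinEpi) => hlift n (Z := ((toLaxData M).obj t.pt).obj n)
    (fun j => Hom.app (t.π.app j) n) (fun f => by rw [← t.w f]; rfl)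
  let L (t : Cone F) : (toLaxData M).obj t.pt ⟶ A := LaxData.homMk (l t)
    (fun {n m} f => hext _ _ _ fun j => by
      have hk : A.map f ≫ p j n = p j m ≫ _ := LaxData.Hom.map_app (k j) f
      rw [Category.assoc, hl, LaxData.Hom.map_app, Category.assoc, hk, ← Category.assoc, hl])
    (fun n m => hext _ _ _ fun j => by
      rw [Category.assoc, hl, LaxData.Hom.lax_app, Category.assoc, hlax,
        tensorHom_comp_tensorHom_assoc, hl, hl])
    (hext _ _ _ fun j => by rw [Category.assoc, hl, LaxData.Hom.unit_app, hunit])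
  exact ⟨⟨s,
    { lift t := fullyFaithfulToLaxData.preimage (L t)
      fac t j := hom_ext fun n => hl t n j
      uniq t m hm := hom_ext fun n => hext _ _ _ fun j => by
        exact (congr_arg (fun φ => Hom.app φ n) (hm j)).trans (hl t n j).symm }⟩⟩⟩

section

variable [MonoidalClosed M] [HasColimits M]

/-- Sifted colimits of commutative premonoids are computed levelwise. -/
instance preservesColimitsOfShape_forget (J : Type v) [SmallCategory J] [IsSifted J] :
    PreservesColimitsOfShape J (forget M) := ⟨fun {F} => by
  let c := colimit.cocone (F ⋙ forget M)
  have hc (n : FinEpi) := isColimitOfPreserves ((evaluation FinEpiᵒᵖ M).obj (op n))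
    (colimit.isColimit (F ⋙ forget M))
  let p (j : J) (n : FinEpi) : ((toLaxData M).obj (F.obj j)).obj n ⟶ c.pt.obj (op n) :=
    (c.ι.app j).app (op n)
  have hp {i j} (f : i ⟶ j) (n : FinEpi) : Hom.app (F.map f) n ≫ p j n = p i n :=
    NatTrans.congr_app (c.w f) (op n)
  have hext (n : FinEpi) {Z : M} (a b : c.pt.obj (op n) ⟶ Z) (h : ∀ j, p j n ≫ a = p j n ≫ b) :
      a = b := (hc n).hom_ext h
  have hext₀ (n : FinEpi) {Z : M} (a b : 𝟙_ M ⊗ c.pt.obj (op n) ⟶ Z)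
      (h : ∀ j, (𝟙 _ ⊗ₘ p j n) ≫ a = (𝟙 _ ⊗ₘ p j n) ≫ b) : a = b :=
    (cancel_epi (λ_ (c.pt.obj (op n))).inv).1 (hext _ _ _ fun j => by
      rw [leftUnitor_inv_naturality_assoc, leftUnitor_inv_naturality_assoc, ← id_tensorHom, h])
  have hext₂ (n m : FinEpi) {Z : M} (a b : c.pt.obj (op n) ⊗ c.pt.obj (op m) ⟶ Z)
      (h : ∀ j, (p j n ⊗ₘ p j m) ≫ a = (p j n ⊗ₘ p j m) ≫ b) : a = b :=
    tensor_hom_ext_of_isSifted (hc n) (hc m) h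
  have hext₃ (n m k : FinEpi) {Z : M}
      (a b : (c.pt.obj (op n) ⊗ c.pt.obj (op m)) ⊗ c.pt.obj (op k) ⟶ Z)
      (h : ∀ j, ((p j n ⊗ₘ p j m) ⊗ₘ p j k) ≫ a = ((p j n ⊗ₘ p j m) ⊗ₘ p j k) ≫ b) : a = b :=
    tensor₃_hom_ext_of_isSifted (hc n) (hc m) (hc k) h
  have hcompat {i j} (f : i ⟶ j) (n m : FinEpi) :
      (Hom.app (F.map f) n ⊗ₘ Hom.app (F.map f) m) ≫
        ((toLaxData M).obj (F.obj j)).lax n m ≫ p j (FinEpi.add n m) =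
      ((toLaxData M).obj (F.obj i)).lax n m ≫ p i (FinEpi.add n m) := by
    rw [← reassoc_of% (LaxData.Hom.lax_app ((toLaxData M).map (F.map f)) n m), hp]
  have hdesc (n m : FinEpi) : ∃ k : c.pt.obj (op n) ⊗ c.pt.obj (op m) ⟶
      c.pt.obj (op (FinEpi.add n m)), ∀ j, (p j n ⊗ₘ p j m) ≫ k =
        ((toLaxData M).obj (F.obj j)).lax n m ≫ p j (FinEpi.add n m) :=
    exists_desc_tensor_of_isSifted (hc n) (hc m) _ fun f => hcompat f n m
  choose lax hlax using hdesc
  let unit (j : J) : 𝟙_ M ⟶ c.pt.obj (op FinEpi.one) :=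
    ((toLaxData M).obj (F.obj j)).unit ≫ p j FinEpi.one
  have hunit {i j} (f : i ⟶ j) : unit i = unit j := by
    dsimp only [unit]
    rw [← hp f, reassoc_of% (LaxData.Hom.unit_app ((toLaxData M).map (F.map f)))]
  -- The unit of the colimit may be taken from any `j`, because a sifted category is connected.
  have : IsConnected J := inferInstance
  let j₀ : J := Classical.arbitrary J
  have hunit' (j : J) : unit j = unit j₀ :=
    constant_of_preserves_morphisms unit (fun _ _ f => hunit f) j j₀
  let A : LaxData M := { diagram := c.pt, lax := lax, unit := unit j₀ }
  let k (j : J) : (toLaxData M).obj (F.obj j) ⟶ A :=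
    { nat := c.ι.app j, nat_lax n m := (hlax n m j).symm, nat_unit := hunit' j }
  have hA : A.IsPremonoid := fun l => by
    have h (j : J) : l.srcMap (k j) ≫ l.lhs A = l.srcMap (k j) ≫ l.rhs A := by
      rw [← Law.lhs_app, ← Law.rhs_app, (F.obj j).isPremonoid]
    cases l with
    | natural f g => exact hext₂ _ _ _ _ h
    | assoc n m k => exact hext₃ _ _ _ _ _ h
    | symm n m => exact hext₂ _ _ _ _ h
    | unit =>
      exact hext₀ _ _ _ h
  let s : Cocone F :=
    { pt := hA.toCommPremonoid
      ι :=
        { app j := fullyFaithfulToLaxData.preimage (k j)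
          naturality i j f := hom_ext fun n =>
            (hp f n).trans (Category.comp_id _).symm } }
  let T (t : Cocone F) (j : J) : (toLaxData M).obj (F.obj j) ⟶ (toLaxData M).obj t.pt :=
    (toLaxData M).map (t.ι.app j)
  have hdesc (t : Cocone F) : ∃ l : ∀ n, A.obj n ⟶ ((toLaxData M).obj t.pt).obj n, ∀ j n,
      p j n ≫ l n = LaxData.Hom.app (T t j) n :=
    ⟨fun n => (colimit.desc _ ((forget M).mapCocone t)).app (op n), fun j n =>
      NatTrans.congr_app (colimit.ι_desc ((forget M).mapCocone t) j) (op n)⟩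
  choose l hl using hdesc
  let L (t : Cocone F) : A ⟶ (toLaxData M).obj t.pt := LaxData.homMk (l t)
    (fun {n m} f => hext _ _ _ fun j => by
      have hk : _ ≫ p j n = p j m ≫ A.map f := LaxData.Hom.map_app (k j) f
      rw [← Category.assoc, ← hk, Category.assoc, hl, LaxData.Hom.map_app, ← Category.assoc, hl])
    (fun n m => hext₂ _ _ _ _ fun j => by
      rw [reassoc_of% (hlax n m j), hl, LaxData.Hom.lax_app, tensorHom_comp_tensorHom_assoc, hl,
        hl])
    (by
      change (_ ≫ _) ≫ _ = _
      rw [Category.assoc, hl, LaxData.Hom.unit_app])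
  have hs : IsColimit s :=
    { desc t := fullyFaithfulToLaxData.preimage (L t)
      fac t j := hom_ext fun n => hl t j n
      uniq t m hm := hom_ext fun n => hext _ _ _ fun j => by
        exact (congr_arg (fun φ => Hom.app φ n) (hm j)).trans (hl t j n).symm }
  exact preservesColimit_of_preserves_colimit_cocone hs
    (IsColimit.ofIsoColimit (colimit.isColimit (F ⋙ forget M))
      (Cocone.ext (Iso.refl _) fun _ => Category.comp_id _))⟩

end

end CommPremonoid

end CoSegal

/-! ### Local presentability of premonoids -/

namespace CoSegal.CommPremonoid

variable {M : Type u} [Category.{v} M] [MonoidalCategory M] [SymmetricCategory M]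

/-- The evaluation of a commutative premonoid at a nonempty finite set. -/
abbrev ev (n : FinEpi) : CommPremonoid M ⥤ M :=
  forget M ⋙ (evaluation FinEpiᵒᵖ M).obj (op n)

lemma isIso_of_isIso_app {F G : CommPremonoid M} (σ : F ⟶ G) (h : ∀ n, IsIso ((ev n).map σ)) :
    IsIso σ := by
  have := LaxData.isIso_of_isIso_app ((toLaxData M).map σ) h
  exact isIso_of_reflects_iso σ (toLaxData M)

section

variable [MonoidalClosed M] [HasColimits M]

instance isRightAdjoint_ev (n : FinEpi) : (ev (M := M) n).IsRightAdjoint := by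
  have : ((evaluation FinEpiᵒᵖ M).obj (op n)).IsRightAdjoint :=
    ⟨_, ⟨evaluationAdjunctionRight M (op n)⟩⟩
  infer_instance

instance isCardinalAccessible_ev (κ : Cardinal.{v}) [Fact κ.IsRegular] (n : FinEpi) :
    (ev (M := M) n).IsCardinalAccessible κ where
  preservesColimitOfShape J _ _ := by
    have := isFiltered_of_isCardinalFiltered J κ
    have : IsSifted J := IsFiltered.isSifted
    infer_instance

end

variable [MonoidalClosed M]

/-- The left adjoints of all the evaluations, applied to a strong generator of `κ`-presentable
objects of `M`, give one for premonoids: the evaluations are jointly faithful and conservative, and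
their accessibility makes the left adjoints preserve `κ`-presentability. -/
instance isCardinalLocallyPresentable (κ : Cardinal.{v}) [Fact κ.IsRegular]
    [IsCardinalLocallyPresentable M κ] : IsCardinalLocallyPresentable (CommPremonoid M) κ := by
  obtain ⟨P, _, hP, hPκ⟩ :=
    (IsCardinalLocallyPresentable.iff_exists_isStrongGenerator M κ).1 inferInstance
  rw [IsCardinalLocallyPresentable.iff_exists_isStrongGenerator]
  let L (n : FinEpi) : M ⥤ CommPremonoid M := (ev n).leftAdjoint
  let adj (n : FinEpi) : L n ⊣ ev n := Adjunction.ofIsRightAdjoint _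
  let Q : ObjectProperty (CommPremonoid M) :=
    .ofObj fun i : FinEpi × Subtype P => (L i.1).obj i.2.1
  have hQ (n : FinEpi) {G : M} (hG : P G) : Q ((L n).obj G) :=
    ⟨(⟨n, ⟨G, hG⟩⟩ : FinEpi × Subtype P)⟩
  have hS : ObjectProperty.Small.{v} Q := inferInstance
  refine ⟨Q, hS, ?_, ?_⟩
  · rw [ObjectProperty.isStrongGenerator_iff]
    refine ⟨fun X Y f g h => hom_ext fun n => hP.isSeparating _ _ fun G hG (p : G ⟶ (ev n).obj X) => ?_,
      fun X Y i _ hi => isIso_of_isIso_app i fun n => hP.isIso_of_mono _ fun G hG (p : G ⟶ (ev n).obj Y) => ?_⟩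
    · have := congr_arg ((adj n).homEquiv _ _) (h _ (hQ n hG) (((adj n).homEquiv _ _).symm p))
      rw [Adjunction.homEquiv_naturality_right, Adjunction.homEquiv_naturality_right,
        Equiv.apply_symm_apply] at this
      exact this
    · obtain ⟨q, hq⟩ := hi _ (hQ n hG) (((adj n).homEquiv _ _).symm p)
      refine ⟨(adj n).homEquiv _ _ q, ?_⟩
      have := congr_arg ((adj n).homEquiv _ _) hq
      rw [Equiv.apply_symm_apply] at this
      dsimp only at this ⊢
      rw [← this, Adjunction.homEquiv_naturality_right]
  · rintro _ ⟨n, G, hG⟩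
    have : IsCardinalPresentable G κ := hPκ _ hG
    exact (adj n).isCardinalPresentable_leftAdjoint_obj κ G

lemma isLocallyPresentable [IsLocallyPresentable.{v} M] :
    IsLocallyPresentable.{v} (CommPremonoid M) := by
  obtain ⟨κ, _, _⟩ := IsLocallyPresentable.exists_cardinal.{v} M
  exact ⟨κ, inferInstance, inferInstance⟩

end CoSegal.CommPremonoid

/-! ### Cofree premonoids, and pushouts at the one element set -/

lemma CategoryTheory.IsPushout.of_existsUnique {C : Type*} [Category* C] {A B X Y : C}
    {f : A ⟶ B} {g : A ⟶ X} {h : B ⟶ Y} {k : X ⟶ Y} (w : f ≫ h = g ≫ k)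
    (H : ∀ {Z : C} (b : B ⟶ Z) (x : X ⟶ Z), f ≫ b = g ≫ x → ∃! d, h ≫ d = b ∧ k ≫ d = x) :
    IsPushout f g h k :=
  ⟨⟨w⟩, ⟨PushoutCocone.IsColimit.mk w (fun s => (H _ _ s.condition).choose)
    (fun s => (H _ _ s.condition).choose_spec.1.1) (fun s => (H _ _ s.condition).choose_spec.1.2)
    fun s _ h₁ h₂ => (H _ _ s.condition).choose_spec.2 _ ⟨h₁, h₂⟩⟩⟩

namespace CoSegal

lemma FinEpi.card_one : one.card = 1 := rfl

lemma FinEpi.card_le {n m : FinEpi} (f : n ⟶ m) : m.card ≤ n.card := by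
  simpa using Fintype.card_le_of_surjective f.1 f.2

lemma FinEpi.card_eq_one {n m : FinEpi} (f : n ⟶ m) (h : n.card = 1) : m.card = 1 :=
  le_antisymm ((card_le f).trans h.le) m.card_pos

/-- The combinatorial heart of the theorem: no laxity map lands in level 1, so laxity imposes
nothing on `F(1)`. -/
lemma FinEpi.card_add_ne_one (n m : FinEpi) : (add n m).card ≠ 1 := by
  have := n.card_pos
  have := m.card_pos
  change n.card + m.card ≠ 1
  lia

instance (n : FinEpi) : Subsingleton (n ⟶ FinEpi.one) :=
  ⟨fun _ _ => Subtype.ext (funext fun _ => Subsingleton.elim (α := Fin 1) _ _)⟩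

/-- A set with one element is isomorphic to `FinEpi.one`. -/
def FinEpi.ofOne {n : FinEpi} (h : n.card = 1) : one ⟶ n :=
  ⟨finCongr h.symm, (finCongr _).surjective⟩

namespace CommPremonoid

section

variable {M : Type u} [Category.{v} M] [HasFiniteProducts M] {W : M}

/-- The diagram which is `W` at the one element set and terminal at the other sets. -/
noncomputable def cofreeDiagram (W : M) : FinEpiᵒᵖ ⥤ M where
  -- A product indexed by a proposition is `W` or terminal according to whether the proposition
  -- holds, with no case split.
  obj n := ∏ᶜ fun _ : PLift (n.unop.card = 1) => W
  map f := Pi.lift fun h => Pi.π _ ⟨FinEpi.card_eq_one f.unop h.down⟩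
  map_id n := Limits.Pi.hom_ext _ _ fun _ => by simp
  map_comp f g := Limits.Pi.hom_ext _ _ fun _ => by simp

/-- The value of `cofreeDiagram W` at a one element set. -/
noncomputable def cofreeDiagramπ (W : M) {n : FinEpiᵒᵖ} (h : n.unop.card = 1) :
    (cofreeDiagram W).obj n ⟶ W :=
  Pi.π (fun _ : PLift (n.unop.card = 1) => W) ⟨h⟩

lemma cofreeDiagram_map_π {n m : FinEpiᵒᵖ} (f : n ⟶ m) (h : m.unop.card = 1) :
    (cofreeDiagram W).map f ≫ cofreeDiagramπ W h =
      cofreeDiagramπ W (FinEpi.card_eq_one f.unop h) :=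
  Pi.lift_π _ _

lemma cofreeDiagram_hom_ext' {X : M} {n : FinEpiᵒᵖ} {f g : X ⟶ (cofreeDiagram W).obj n}
    (H : ∀ h : n.unop.card = 1, f ≫ cofreeDiagramπ W h = g ≫ cofreeDiagramπ W h) : f = g :=
  Limits.Pi.hom_ext _ _ fun h => H h.down

lemma cofreeDiagram_hom_ext {X : M} {n : FinEpi} (hn : n.card ≠ 1)
    (f g : X ⟶ (cofreeDiagram W).obj (op n)) : f = g :=
  cofreeDiagram_hom_ext' fun h => (hn h).elim

/-- The universal property of the values of `cofreeDiagram W`. -/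
noncomputable def cofreeDiagramObjLift {X : M} {n : FinEpiᵒᵖ} (w : n.unop.card = 1 → (X ⟶ W)) :
    X ⟶ (cofreeDiagram W).obj n :=
  Pi.lift fun h => w h.down

lemma cofreeDiagramObjLift_π {X : M} {n : FinEpiᵒᵖ} (w : n.unop.card = 1 → (X ⟶ W))
    (h : n.unop.card = 1) : cofreeDiagramObjLift w ≫ cofreeDiagramπ W h = w h :=
  Pi.lift_π _ _

/-- A morphism into `cofreeDiagram W` is determined by a morphism into `W`. -/
noncomputable def cofreeDiagramLift {F : FinEpiᵒᵖ ⥤ M} (w : F.obj (op FinEpi.one) ⟶ W) :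
    F ⟶ cofreeDiagram W where
  app n := cofreeDiagramObjLift fun h => F.map (FinEpi.ofOne h).op ≫ w
  naturality n m f := cofreeDiagram_hom_ext' fun h => by
    rw [Category.assoc, Category.assoc, cofreeDiagram_map_π, cofreeDiagramObjLift_π,
      cofreeDiagramObjLift_π, ← F.map_comp_assoc]
    congr 2
    refine Quiver.Hom.unop_inj (Subtype.ext (funext fun i => ?_))
    have : Subsingleton (Fin n.unop.card) :=
      FinEpi.card_eq_one f.unop h ▸ inferInstanceAs (Subsingleton (Fin 1))
    exact Subsingleton.elim (α := Fin n.unop.card) _ _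

lemma cofreeDiagramLift_app {F : FinEpiᵒᵖ ⥤ M} (w : F.obj (op FinEpi.one) ⟶ W) :
    (cofreeDiagramLift w).app (op FinEpi.one) ≫ cofreeDiagramπ W FinEpi.card_one = w := by
  refine (cofreeDiagramObjLift_π (n := op FinEpi.one)
    (fun h => F.map (FinEpi.ofOne h).op ≫ w) _).trans ?_
  have : FinEpi.ofOne (n := FinEpi.one) FinEpi.card_one = 𝟙 _ := Subsingleton.elim _ _
  rw [this, op_id, F.map_id, Category.id_comp]

lemma cofreeDiagram_natTrans_ext {F : FinEpiᵒᵖ ⥤ M} {σ τ : F ⟶ cofreeDiagram W}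
    (h : σ.app (op FinEpi.one) = τ.app (op FinEpi.one)) : σ = τ := by
  ext n
  refine cofreeDiagram_hom_ext' fun hn => ?_
  have (ρ : F ⟶ cofreeDiagram W) : ρ.app n ≫ cofreeDiagramπ W hn =
      F.map (FinEpi.ofOne hn).op ≫ ρ.app (op FinEpi.one) ≫ cofreeDiagramπ W FinEpi.card_one := by
    rw [ρ.naturality_assoc]
    exact congr_arg _ (cofreeDiagram_map_π (FinEpi.ofOne hn).op _).symm
  rw [this, this, h]

/-- The value of `cofreeDiagram W` at the one element set. -/
noncomputable def cofreeDiagramIso (W : M) : (cofreeDiagram W).obj (op FinEpi.one) ≅ W where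
  hom := cofreeDiagramπ W FinEpi.card_one
  inv := cofreeDiagramObjLift fun _ => 𝟙 W
  hom_inv_id := cofreeDiagram_hom_ext' fun h => by
    rw [Category.assoc, cofreeDiagramObjLift_π, Category.comp_id, Category.id_comp]
  inv_hom_id := cofreeDiagramObjLift_π _ _

end

variable {M : Type u} [Category.{v} M] [MonoidalCategory M] [SymmetricCategory M]

/-- The unit of a commutative premonoid. -/
def unitHom (F : CommPremonoid M) : 𝟙_ M ⟶ (evOne M).obj F := F.unit

lemma unitHom_evOne_map {F G : CommPremonoid M} (σ : F ⟶ G) :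
    F.unitHom ≫ (evOne M).map σ = G.unitHom :=
  Hom.nat_unit σ

variable [HasFiniteProducts M] {W : M}

/-- The commutative premonoid which is `W` at the one element set and terminal at the
other sets. -/
noncomputable def cofree (e : 𝟙_ M ⟶ W) : CommPremonoid M where
  diagram := cofreeDiagram W
  lax n m := Pi.lift fun h => (FinEpi.card_add_ne_one n m h.down).elim
  lax_natural _ _ := cofreeDiagram_hom_ext (FinEpi.card_add_ne_one _ _) _ _
  lax_assoc _ _ _ := cofreeDiagram_hom_ext (FinEpi.card_add_ne_one _ _) _ _
  lax_symm _ _ := cofreeDiagram_hom_ext (FinEpi.card_add_ne_one _ _) _ _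
  unit := e ≫ (cofreeDiagramIso W).inv
  unit_lax := cofreeDiagram_hom_ext (FinEpi.card_add_ne_one _ _) _ _

/-- The value of `cofree e` at the one element set. -/
noncomputable def cofreeIso (e : 𝟙_ M ⟶ W) : (evOne M).obj (cofree e) ≅ W :=
  cofreeDiagramIso W

lemma cofree_hom_ext {F : CommPremonoid M} {e : 𝟙_ M ⟶ W} {σ τ : F ⟶ cofree e}
    (h : (evOne M).map σ ≫ (cofreeIso e).hom = (evOne M).map τ ≫ (cofreeIso e).hom) : σ = τ := by
  have : (evOne M).map σ = (evOne M).map τ := (cancel_mono _).1 h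
  exact Hom.ext (cofreeDiagram_natTrans_ext this)

/-- The laxity conditions take place at levels of cardinality at least 2, where the target is
terminal; only compatibility with the unit remains. -/
lemma exists_hom_cofree (F : CommPremonoid M) {e : 𝟙_ M ⟶ W} (w : (evOne M).obj F ⟶ W)
    (hw : F.unitHom ≫ w = e) : ∃ σ : F ⟶ cofree e, (evOne M).map σ ≫ (cofreeIso e).hom = w := by
  refine ⟨{
    nat := cofreeDiagramLift w
    nat_lax n m := cofreeDiagram_hom_ext (FinEpi.card_add_ne_one _ _) _ _
    nat_unit := ?_ }, cofreeDiagramLift_app w⟩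
  refine (cofreeDiagramIso W).eq_comp_inv.2 ?_ |>.trans rfl
  exact (Category.assoc _ _ _).trans ((congr_arg _ (cofreeDiagramLift_app w)).trans hw)

/-- Two maps `b`, `x` to `W` that agree on `A(1)` induce the same unit `I ⟶ W`, hence become maps to
a single cofree premonoid, where the pushout of premonoids applies. In effect, pushouts under `I`
are pushouts in `M`. -/
lemma isPushout_evOne_map {A B X Y : CommPremonoid M} {f : A ⟶ B} {g : A ⟶ X} {h : B ⟶ Y}
    {k : X ⟶ Y} (sq : IsPushout f g h k) :
    IsPushout ((evOne M).map f) ((evOne M).map g) ((evOne M).map h) ((evOne M).map k) := by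
  refine .of_existsUnique (by rw [← Functor.map_comp, sq.w, Functor.map_comp]) fun b x hbx => ?_
  have hb : B.unitHom ≫ b = A.unitHom ≫ (evOne M).map f ≫ b := by
    rw [← Category.assoc, unitHom_evOne_map]
  have hx : X.unitHom ≫ x = A.unitHom ≫ (evOne M).map f ≫ b := by
    rw [hbx, ← Category.assoc, unitHom_evOne_map]
  obtain ⟨σ, hσ⟩ := exists_hom_cofree B b hb
  obtain ⟨τ, hτ⟩ := exists_hom_cofree X x hx
  have hστ : f ≫ σ = g ≫ τ := cofree_hom_ext (by
    rw [Functor.map_comp, Functor.map_comp, Category.assoc, Category.assoc, hσ, hτ, hbx])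
  refine ⟨(evOne M).map (sq.desc σ τ hστ) ≫ (cofreeIso _).hom, ⟨?_, ?_⟩, fun m ⟨h₁, h₂⟩ => ?_⟩
  · rw [← Functor.map_comp_assoc, sq.inl_desc, hσ]
  · rw [← Functor.map_comp_assoc, sq.inr_desc, hτ]
  · obtain ⟨ρ, hρ⟩ := exists_hom_cofree Y (e := A.unitHom ≫ (evOne M).map f ≫ b) m (by
      rw [← hb, ← h₁, ← Category.assoc, unitHom_evOne_map])
    have : ρ = sq.desc σ τ hστ := sq.hom_ext
      (cofree_hom_ext (by rw [sq.inl_desc, Functor.map_comp, Category.assoc, hρ, h₁, hσ]))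
      (cofree_hom_ext (by rw [sq.inr_desc, Functor.map_comp, Category.assoc, hρ, h₂, hτ]))
    rw [← this, hρ]

/-- The reason is `L(X)(1) = X ⨿ I`. The proof avoids this formula by testing against the cofree
premonoid on `W` whose unit is the one forced by `x`. -/
lemma isPushout_unit {L : M ⥤ CommPremonoid M} (adj : L ⊣ evOne M) {X Y : M} (i : X ⟶ Y) :
    IsPushout i (adj.unit.app X) (adj.unit.app Y) ((evOne M).map (L.map i)) := by
  refine .of_existsUnique (adj.unit.naturality i) fun {W} b x hbx => ?_
  obtain ⟨σ, hσ⟩ := exists_hom_cofree (L.obj X) x rfl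
  obtain ⟨ρ, hρ⟩ : ∃ ρ : L.obj Y ⟶ cofree ((L.obj X).unitHom ≫ x),
      adj.unit.app Y ≫ (evOne M).map ρ ≫ (cofreeIso _).hom = b :=
    ⟨(adj.homEquiv Y _).symm (b ≫ (cofreeIso _).inv), by
      have := (adj.homEquiv Y _).apply_symm_apply
        (b ≫ (cofreeIso ((L.obj X).unitHom ≫ x)).inv)
      rw [adj.homEquiv_unit] at this
      rw [reassoc_of% this, Iso.inv_hom_id, Category.comp_id]⟩
  have ext {Z : M} {σ τ : L.obj Z ⟶ cofree ((L.obj X).unitHom ≫ x)}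
      (h : adj.unit.app Z ≫ (evOne M).map σ ≫ (cofreeIso _).hom =
        adj.unit.app Z ≫ (evOne M).map τ ≫ (cofreeIso _).hom) : σ = τ := by
    refine (adj.homEquiv _ _).injective ?_
    rw [adj.homEquiv_unit, adj.homEquiv_unit, ← cancel_mono (cofreeIso _).hom, Category.assoc,
      Category.assoc, h]
  have hρσ : L.map i ≫ ρ = σ := ext (by
    have := adj.unit_naturality i
    rw [hσ, ← hbx, Functor.map_comp, Category.assoc, reassoc_of% this, hρ])
  refine ⟨(evOne M).map ρ ≫ (cofreeIso _).hom, ⟨hρ, ?_⟩, fun m ⟨h₁, h₂⟩ => ?_⟩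
  · rw [← Functor.map_comp_assoc, hρσ, hσ]
  · obtain ⟨τ, hτ⟩ := exists_hom_cofree (L.obj Y) (e := (L.obj X).unitHom ≫ x) m (by
      rw [← h₂, ← Category.assoc, unitHom_evOne_map])
    have : τ = ρ := ext (by rw [hτ, hρ, h₁])
    rw [← this, hτ]

end CommPremonoid

end CoSegal

/-! ### Transfer of model structures along cellular adjunctions -/

section

variable {C : Type*} [Category* C] {D : Type*} [Category* D]

lemma CategoryTheory.Adjunction.rlp_strictMap {L : D ⥤ C} {U : C ⥤ D} (adj : L ⊣ U)
    (I : MorphismProperty D) : (I.strictMap L).rlp = I.rlp.inverseImage U := by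
  ext X Y p
  refine ⟨fun h A B i hi => (adj.hasLiftingProperty_iff i p).1 (h _ ⟨hi⟩), ?_⟩
  rintro h _ _ _ ⟨hi⟩
  exact (adj.hasLiftingProperty_iff _ p).2 (h _ hi)

end

namespace HomotopicalAlgebra

/-- An adjunction `L ⊣ U` such that `U` preserves pushouts, and such that the unit is
a pushout along every morphism. -/
structure IsCellular {D : Type*} [Category* D] {C : Type*} [Category* C] {L : D ⥤ C} {U : C ⥤ D}
    (adj : L ⊣ U) : Prop where
  isPushout_map {A B X Y : C} {f : A ⟶ B} {g : A ⟶ X} {h : B ⟶ Y} {k : X ⟶ Y}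
    (sq : IsPushout f g h k) : IsPushout (U.map f) (U.map g) (U.map h) (U.map k)
  isPushout_unit {X Y : D} (i : X ⟶ Y) :
    IsPushout i (adj.unit.app X) (adj.unit.app Y) (U.map (L.map i))

namespace IsCellular

section

variable {D : Type*} [Category* D] {C : Type*} [Category* C] {L : D ⥤ C} {U : C ⥤ D}
  {adj : L ⊣ U} (h : IsCellular adj)

include h

/-- Any factorization of `U.map f` lifts to a factorization of `f`, whose first map is a pushout
of the image of the first map by the left adjoint. -/
lemma exists_factorization [HasPushouts C] {X Y : C} (f : X ⟶ Y) {Z : D} (i : U.obj X ⟶ Z)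
    (p : Z ⟶ U.obj Y) (fac : i ≫ p = U.map f) :
    ∃ (E : C) (j : X ⟶ E) (t : L.obj Z ⟶ E) (q : E ⟶ Y) (e : Z ≅ U.obj E),
      IsPushout (L.map i) (adj.counit.app X) t j ∧ j ≫ q = f ∧ i ≫ e.hom = U.map j ∧
      e.hom ≫ U.map q = p := by
  let j := pushout.inr (L.map i) (adj.counit.app X)
  let t := pushout.inl (L.map i) (adj.counit.app X)
  have sq : IsPushout (L.map i) (adj.counit.app X) t j := IsPushout.of_hasPushout _ _
  have w : L.map i ≫ (adj.homEquiv _ _).symm p = adj.counit.app X ≫ f := by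
    rw [← adj.homEquiv_naturality_left_symm, fac, adj.homEquiv_counit, adj.counit_naturality]
  -- Apply `U` to the pushout defining `E` and paste it to the unit square of `i`; a triangle
  -- identity turns one side into an identity, so `Z ≅ U.obj E`.
  have sq' : IsPushout i (𝟙 _) (adj.unit.app Z ≫ U.map t) (U.map j) := by
    have := (h.isPushout_unit i).paste_vert (h.isPushout_map sq)
    rwa [adj.right_triangle_components] at this
  have : IsIso (adj.unit.app Z ≫ U.map t) := sq'.isIso_inl_of_isIso
  refine ⟨_, j, t, sq.desc _ _ w, asIso (adj.unit.app Z ≫ U.map t), sq, sq.inr_desc _ _ _, ?_, ?_⟩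
  · exact sq'.w.trans (Category.id_comp _)
  · rw [asIso_hom, Category.assoc, ← U.map_comp, sq.inl_desc, ← adj.homEquiv_unit,
      Equiv.apply_symm_apply]

end

/-- Weak factorization systems are transferred along cellular adjunctions. -/
lemma exists_factorization_of_wfs {D : Type*} [Category* D] {C : Type*} [Category* C]
    {L : D ⥤ C} {U : C ⥤ D} {adj : L ⊣ U} (h : IsCellular adj) [HasPushouts C]
    (P Q : MorphismProperty D) [P.IsWeakFactorizationSystem Q] {X Y : C} (f : X ⟶ Y) :
    ∃ (E : C) (j : X ⟶ E) (q : E ⟶ Y), j ≫ q = f ∧ (Q.inverseImage U).llp j ∧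
      P.inverseImage U j ∧ Q.inverseImage U q := by
  let d := MorphismProperty.factorizationData P Q (U.map f)
  obtain ⟨E, j, t, q, e, sq, hf, hj, hq⟩ := h.exists_factorization f d.i d.p d.fac
  have : P.RespectsIso := by
    rw [← MorphismProperty.llp_eq_of_wfs P Q]
    infer_instance
  have : Q.RespectsIso := by
    rw [← MorphismProperty.rlp_eq_of_wfs P Q]
    infer_instance
  refine ⟨E, j, q, hf, ?_, ?_, ?_⟩
  · refine MorphismProperty.of_isPushout (P := (Q.inverseImage U).llp) sq.flip fun A B p hp => ?_
    rw [adj.hasLiftingProperty_iff]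
    exact MorphismProperty.hasLiftingProperty_of_wfs (W₁ := P) (W₂ := Q) _ _ d.hi hp
  · change P (U.map j)
    rw [← hj]
    exact (P.cancel_right_of_respectsIso _ _).2 d.hi
  · change Q (U.map q)
    rw [← Q.cancel_left_of_respectsIso e.hom, hq]
    exact d.hp

end IsCellular

/-- A model category structure on `C` is transferred along `U : C ⥤ D` if the weak equivalences
and the fibrations are the morphisms that `U` sends to weak equivalences and fibrations. -/
structure IsTransferred {D : Type*} [Category* D] [ModelCategory D] {C : Type*} [Category* C]
    [ModelCategory C] (U : C ⥤ D) : Prop where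
  weakEquivalences_eq : weakEquivalences C = (weakEquivalences D).inverseImage U
  fibrations_eq : fibrations C = (fibrations D).inverseImage U

/-- The usual acyclicity condition is automatic: the first factor of a lifted factorization is sent
by `U` to the first factor chosen in `D`, up to isomorphism, hence to a weak equivalence when that
one is a trivial cofibration. -/
lemma IsCellular.exists_isTransferred {D : Type*} [Category* D] [ModelCategory D] {C : Type*}
    [Category* C] [HasFiniteLimits C] [HasFiniteColimits C] {L : D ⥤ C} {U : C ⥤ D} {adj : L ⊣ U}
    (h : IsCellular adj) : ∃ _ : ModelCategory C, IsTransferred U := by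
  let W := (weakEquivalences D).inverseImage U
  let Fib := (fibrations D).inverseImage U
  let TF := (trivialFibrations D).inverseImage U
  have hTF : Fib.llp ≤ TF.llp := MorphismProperty.antitone_llp fun _ _ _ hp => hp.1
  -- Retract argument: in the factorization `f = j ≫ q`, two-out-of-three puts `q` in `TF`, so `f`
  -- lifts against `q` and is a retract of `j`.
  have key {X Y : C} (f : X ⟶ Y) (hf : TF.llp f) (hf' : W f) : Fib.llp f := by
    obtain ⟨E, j, q, fac, hj, hj', hq⟩ :=
      h.exists_factorization_of_wfs (trivialCofibrations D) (fibrations D) f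
    have hjW : W j := hj'.2
    have : W q := W.of_precomp j q hjW (by rwa [fac])
    have : HasLiftingProperty f q := hf _ ⟨hq, this⟩
    exact MorphismProperty.of_retract (RetractArrow.ofLeftLiftingProperty fac) hj
  let : CategoryWithWeakEquivalences C := ⟨W⟩
  let : CategoryWithFibrations C := ⟨Fib⟩
  let : CategoryWithCofibrations C := ⟨TF.llp⟩
  have h₁ : weakEquivalences C = W := rfl
  have h₂ : fibrations C = Fib := rfl
  have h₃ : cofibrations C = TF.llp := rfl
  have cm5a : (trivialCofibrations C).HasFactorization (fibrations C) := ⟨fun f => by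
    obtain ⟨E, j, q, fac, hj, hj', hq⟩ :=
      h.exists_factorization_of_wfs (trivialCofibrations D) (fibrations D) f
    exact ⟨{ Z := E, i := j, p := q, fac := fac, hi := ⟨hTF _ hj, hj'.2⟩, hp := hq }⟩⟩
  have cm5b : (cofibrations C).HasFactorization (trivialFibrations C) := ⟨fun f => by
    obtain ⟨E, j, q, fac, hj, hj', hq⟩ :=
      h.exists_factorization_of_wfs (cofibrations D) (trivialFibrations D) f
    exact ⟨{ Z := E, i := j, p := q, fac := fac, hi := hj, hp := hq }⟩⟩
  let m : ModelCategory C :=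
    { cm2 := by rw [h₁]; infer_instance
      cm3a := by rw [h₁]; infer_instance
      cm3b := by rw [h₂]; infer_instance
      cm3c := by rw [h₃]; infer_instance
      cm4a i p hi hi' hp := by
        rw [cofibration_iff, h₃] at hi
        rw [weakEquivalence_iff, h₁] at hi'
        exact key i hi hi' p hp.mem
      cm4b i p hi hp hp' := by
        rw [cofibration_iff, h₃] at hi
        exact hi p ⟨hp.mem, hp'.mem⟩ }
  exact ⟨m, rfl, rfl⟩

namespace IsTransferred

variable {D : Type*} [Category* D] [ModelCategory D] {C : Type*} [Category* C] [ModelCategory C]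
  {L : D ⥤ C} {U : C ⥤ D} (hU : IsTransferred U)

include hU

lemma trivialFibrations_eq : trivialFibrations C = (trivialFibrations D).inverseImage U := by
  rw [trivialFibrations, hU.fibrations_eq, hU.weakEquivalences_eq]
  rfl

lemma weakEquivalence_iff {X Y : C} (f : X ⟶ Y) :
    WeakEquivalence f ↔ WeakEquivalence (U.map f) := by
  rw [HomotopicalAlgebra.weakEquivalence_iff, HomotopicalAlgebra.weakEquivalence_iff,
    hU.weakEquivalences_eq, MorphismProperty.inverseImage_iff]

lemma fibration_iff {X Y : C} (f : X ⟶ Y) : Fibration f ↔ Fibration (U.map f) := by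
  rw [HomotopicalAlgebra.fibration_iff, HomotopicalAlgebra.fibration_iff, hU.fibrations_eq,
    MorphismProperty.inverseImage_iff]

lemma isQuillenAdjunction (adj : L ⊣ U) : ModelCat.IsQuillenAdjunction adj where
  cofibrations_le A B i hi := by
    rw [← MorphismProperty.llp_eq_of_wfs (cofibrations C) (trivialFibrations C),
      hU.trivialFibrations_eq]
    intro X Y p hp
    rw [adj.hasLiftingProperty_iff]
    exact MorphismProperty.hasLiftingProperty_of_wfs (W₁ := cofibrations D)
      (W₂ := trivialFibrations D) _ _ hi hp
  trivialCofibrations_le A B i hi := by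
    rw [← MorphismProperty.llp_eq_of_wfs (trivialCofibrations C) (fibrations C),
      hU.fibrations_eq]
    intro X Y p hp
    rw [adj.hasLiftingProperty_iff]
    exact MorphismProperty.hasLiftingProperty_of_wfs (W₁ := trivialCofibrations D)
      (W₂ := fibrations D) _ _ hi hp
  fibrations_le := hU.fibrations_eq.le
  trivialFibrations_le := hU.trivialFibrations_eq.le

/-- A cofibration is a retract of the first factor of its lifted factorization, which `U` sends to a
cofibration. With preservation of pushouts, this gives left properness. -/
lemma cofibrations_le {adj : L ⊣ U} (h : IsCellular adj) :
    cofibrations C ≤ (cofibrations D).inverseImage U := by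
  intro X Y f hf
  obtain ⟨E, j, q, fac, -, hj, hq⟩ :=
    h.exists_factorization_of_wfs (cofibrations D) (trivialFibrations D) f
  rw [← hU.trivialFibrations_eq] at hq
  have : HasLiftingProperty f q :=
    MorphismProperty.hasLiftingProperty_of_wfs (W₁ := cofibrations C)
      (W₂ := trivialFibrations C) _ _ hf hq
  exact MorphismProperty.of_retract (RetractArrow.ofLeftLiftingProperty fac) hj

lemma isLeftProper [ModelCat.IsLeftProper D] {adj : L ⊣ U} (h : IsCellular adj) :
    ModelCat.IsLeftProper C where
  weakEquivalence_of_isPushout sq hi hf := by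
    rw [hU.weakEquivalence_iff] at hf ⊢
    exact ModelCat.IsLeftProper.weakEquivalence_of_isPushout (h.isPushout_map sq)
      ⟨hU.cofibrations_le h _ hi.mem⟩ hf

end IsTransferred

end HomotopicalAlgebra

/-! ### The small object argument and generating sets -/

namespace CategoryTheory.MorphismProperty

lemma isSmall_strictMap {C : Type*} [Category* C] {D : Type*} [Category* D]
    (I : MorphismProperty C) [IsSmall.{w} I] (F : C ⥤ D) : IsSmall.{w} (I.strictMap F) := by
  obtain ⟨ι, A, B, f, rfl⟩ := (isSmall_iff_eq_ofHoms.{w} I).1 inferInstance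
  have : (ofHoms f).strictMap F = ofHoms fun i => F.map (f i) := by
    ext X Y g
    constructor
    · rintro ⟨⟨i⟩⟩
      exact ⟨i⟩
    · rintro ⟨i⟩
      exact ⟨⟨i⟩⟩
  rw [this]
  infer_instance

lemma isSmall_of_hasSmallObjectArgument {C : Type u} [Category.{v} C] (I : MorphismProperty C)
    [HasSmallObjectArgument.{w} I] : IsSmall.{w} I := by
  obtain ⟨κ, _, _, _⟩ := HasSmallObjectArgument.exists_cardinal.{w} (I := I)
  exact SmallObject.isSmall I κ

/-- Every small set of morphisms of a locally presentable category permits the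
small object argument. -/
lemma hasSmallObjectArgument_of_isSmall {C : Type u} [Category.{v} C] [IsLocallyPresentable.{v} C]
    (I : MorphismProperty C) [IsSmall.{v} I] : HasSmallObjectArgument.{v} I := by
  have : HasColimits C := by
    obtain ⟨κ, _, _⟩ := IsLocallyPresentable.exists_cardinal.{v} C
    infer_instance
  have hI (f : I.toSet) : ∃ (κ : Cardinal.{v}) (_ : Fact κ.IsRegular),
      IsCardinalPresentable f.1.left κ :=
    Functor.IsAccessible.exists_cardinal (self := inferInstanceAs (IsPresentable.{v} f.1.left))
  choose c hc hc' using hI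
  -- A regular cardinal above the presentability ranks of the sources of all maps in the small set
  -- `I`.
  obtain ⟨κ, hκ, hcκ⟩ :=
    HasCardinalLT.exists_regular_cardinal_forall.{v} fun f : I.toSet => (c f).ord.ToType
  have : Fact κ.IsRegular := ⟨hκ⟩
  have : Nonempty κ.ord.ToType := by simpa using hκ.ne_zero
  have := WellFoundedLT.toOrderBot κ.ord.ToType
  refine ⟨κ, inferInstance, inferInstance, { preservesColimit {A B X Y} i hi f hf := ?_ }⟩
  have h : c ⟨CategoryTheory.Arrow.mk i, hi⟩ ≤ κ := by
    have := hcκ ⟨CategoryTheory.Arrow.mk i, hi⟩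
    rw [hasCardinalLT_iff_cardinal_mk_lt] at this
    simpa using this.le
  have : IsCardinalPresentable A (c ⟨CategoryTheory.Arrow.mk i, hi⟩) := hc' ⟨CategoryTheory.Arrow.mk i, hi⟩
  have : IsCardinalPresentable A κ := isCardinalPresentable_of_le A h
  have := preservesColimitsOfShape_of_isCardinalPresentable A κ κ.ord.ToType
  infer_instance

end CategoryTheory.MorphismProperty

namespace HomotopicalAlgebra.IsTransferred

variable {D : Type*} [Category.{v} D] [ModelCategory D] {C : Type*} [Category.{v} C]
  [ModelCategory C] {L : D ⥤ C} {U : C ⥤ D} (hU : IsTransferred U)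
  [IsLocallyPresentable.{v} C] (adj : L ⊣ U)

include hU adj

lemma isGeneratingCofibrations {I : MorphismProperty D}
    (hI : ModelCat.IsGeneratingCofibrations I) :
    ModelCat.IsGeneratingCofibrations (I.strictMap L) where
  smallObjectArgument := by
    have := hI.smallObjectArgument
    have := MorphismProperty.isSmall_of_hasSmallObjectArgument.{v} I
    have := MorphismProperty.isSmall_strictMap.{v} I L
    exact MorphismProperty.hasSmallObjectArgument_of_isSmall _
  rlp_eq := by rw [adj.rlp_strictMap, hI.rlp_eq, hU.trivialFibrations_eq]

lemma isGeneratingTrivialCofibrations {J : MorphismProperty D}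
    (hJ : ModelCat.IsGeneratingTrivialCofibrations J) :
    ModelCat.IsGeneratingTrivialCofibrations (J.strictMap L) where
  smallObjectArgument := by
    have := hJ.smallObjectArgument
    have := MorphismProperty.isSmall_of_hasSmallObjectArgument.{v} J
    have := MorphismProperty.isSmall_strictMap.{v} J L
    exact MorphismProperty.hasSmallObjectArgument_of_isSmall _
  rlp_eq := by rw [adj.rlp_strictMap, hJ.rlp_eq, hU.fibrations_eq]

lemma isCombinatorial [ModelCat.IsCombinatorial D] : ModelCat.IsCombinatorial C where
  isLocallyPresentable := inferInstance
  exists_generatingCofibrations := by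
    obtain ⟨I, hI⟩ := ModelCat.IsCombinatorial.exists_generatingCofibrations (C := D)
    exact ⟨_, hU.isGeneratingCofibrations adj hI⟩
  exists_generatingTrivialCofibrations := by
    obtain ⟨J, hJ⟩ := ModelCat.IsCombinatorial.exists_generatingTrivialCofibrations (C := D)
    exact ⟨_, hU.isGeneratingTrivialCofibrations adj hJ⟩

end HomotopicalAlgebra.IsTransferred

/-! ### The adjunction with evaluation at the one element set, and the theorem -/

namespace CoSegal

/-- The constant diagram functor is left adjoint to the evaluation at the one element set. -/
def constAdjunction (M : Type u) [Category.{v} M] :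
    Functor.const FinEpiᵒᵖ ⊣ (evaluation FinEpiᵒᵖ M).obj (op FinEpi.one) :=
  .mkOfHomEquiv
    { homEquiv X F :=
        { toFun σ := σ.app (op FinEpi.one)
          invFun f :=
            -- The one element set is terminal among nonempty sets and surjections, so a map out of
            -- a constant diagram is determined by its component there.
            { app n := f ≫ F.map (FinEpi.toOne n.unop).op
              naturality n m g := by
                have : n.unop.toOne.op ≫ g = m.unop.toOne.op :=
                  Quiver.Hom.unop_inj (Subsingleton.elim _ _)
                rw [Category.assoc, ← F.map_comp, this]
                exact Category.id_comp _ }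
          left_inv σ := by
            ext n
            exact (σ.naturality (FinEpi.toOne n.unop).op).symm.trans (Category.id_comp _)
          right_inv f := by
            have : (FinEpi.toOne FinEpi.one) = 𝟙 _ := Subsingleton.elim _ _
            change f ≫ F.map (FinEpi.toOne FinEpi.one).op = f
            rw [this, op_id, F.map_id]
            exact Category.comp_id _ } }

namespace CommPremonoid

/-- The left adjoint to the evaluation at the one element set which is obtained from a left
adjoint to the forgetful functor. -/
def evOneAdjunction {M : Type u} [Category.{v} M] [MonoidalCategory M] [SymmetricCategory M]
    {Γ : (FinEpiᵒᵖ ⥤ M) ⥤ CommPremonoid M} (adj : Γ ⊣ forget M) :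
    Functor.const FinEpiᵒᵖ ⋙ Γ ⊣ evOne M :=
  (constAdjunction M).comp adj

lemma isCellular {M : Type u} [Category.{v} M] [MonoidalCategory M] [SymmetricCategory M]
    [HasFiniteProducts M] {L : M ⥤ CommPremonoid M} (adj : L ⊣ evOne M) : IsCellular adj where
  isPushout_map := isPushout_evOne_map
  isPushout_unit := isPushout_unit adj

end CommPremonoid

end CoSegal

theorem theorem4p3 (M : Type u) [Category.{v} M] [MonoidalCategory M] [SymmetricCategory M]
    [MonoidalClosed M] [ModelCategory M] [ModelCat.IsCombinatorial M] [ModelCat.IsLeftProper M] :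
    (CoSegal.CommPremonoid.forget M).IsRightAdjoint ∧
    ∃ _ : ModelCategory (CoSegal.CommPremonoid M),
      (∀ {F G : CoSegal.CommPremonoid M} (σ : F ⟶ G),
        WeakEquivalence σ ↔ WeakEquivalence ((CoSegal.CommPremonoid.evOne M).map σ)) ∧
      (∀ {F G : CoSegal.CommPremonoid M} (σ : F ⟶ G),
        Fibration σ ↔ Fibration ((CoSegal.CommPremonoid.evOne M).map σ)) ∧
      (∀ {F G : CoSegal.CommPremonoid M} (σ : F ⟶ G),
        Cofibration σ ↔ ∀ {X Y : CoSegal.CommPremonoid M} (p : X ⟶ Y),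
          WeakEquivalence p → Fibration p → HasLiftingProperty σ p) ∧
      ModelCat.IsCombinatorial (CoSegal.CommPremonoid M) ∧
      ModelCat.IsLeftProper (CoSegal.CommPremonoid M) ∧
      ∀ (Γ : (CoSegal.FinEpiᵒᵖ ⥤ M) ⥤ CoSegal.CommPremonoid M)
        (_ : Γ ⊣ CoSegal.CommPremonoid.forget M),
        (∀ I : MorphismProperty M, ModelCat.IsGeneratingCofibrations I →
          ModelCat.IsGeneratingCofibrations
            (I.strictMap (Functor.const CoSegal.FinEpiᵒᵖ ⋙ Γ))) ∧
        (∀ J : MorphismProperty M, ModelCat.IsGeneratingTrivialCofibrations J →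
          ModelCat.IsGeneratingTrivialCofibrations
            (J.strictMap (Functor.const CoSegal.FinEpiᵒᵖ ⋙ Γ))) ∧
        ∃ adj : Functor.const CoSegal.FinEpiᵒᵖ ⋙ Γ ⊣ CoSegal.CommPremonoid.evOne M,
          ModelCat.IsQuillenAdjunction adj := by
  have : IsLocallyPresentable.{v} M := ModelCat.IsCombinatorial.isLocallyPresentable
  have : HasColimits M := by
    obtain ⟨κ, _, _⟩ := IsLocallyPresentable.exists_cardinal.{v} M
    infer_instance
  have hr : (CoSegal.CommPremonoid.forget M).IsRightAdjoint := inferInstance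
  have : IsLocallyPresentable.{v} (CoSegal.CommPremonoid M) :=
    CoSegal.CommPremonoid.isLocallyPresentable
  have : HasFiniteLimits (CoSegal.CommPremonoid M) := ⟨fun J _ _ => inferInstance⟩
  let adj := CoSegal.CommPremonoid.evOneAdjunction
    (Adjunction.ofIsRightAdjoint (CoSegal.CommPremonoid.forget M))
  have h := CoSegal.CommPremonoid.isCellular adj
  obtain ⟨m, hU⟩ := h.exists_isTransferred
  refine ⟨hr, m, hU.weakEquivalence_iff, hU.fibration_iff, fun σ => ?_, hU.isCombinatorial adj,
    hU.isLeftProper h, fun Γ hΓ => ?_⟩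
  · refine ⟨fun _ _ _ p _ _ => inferInstance, fun hσ => ⟨?_⟩⟩
    rw [← MorphismProperty.llp_eq_of_wfs (cofibrations _) (trivialFibrations _)]
    exact fun X Y p hp => hσ p ⟨hp.2⟩ ⟨hp.1⟩
  · let adjΓ := CoSegal.CommPremonoid.evOneAdjunction hΓ
    exact ⟨fun _ => hU.isGeneratingCofibrations adjΓ,
      fun _ => hU.isGeneratingTrivialCofibrations adjΓ, adjΓ, hU.isQuillenAdjunction adjΓ⟩
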